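/- **Setting.** Let $\mathcal X$ be a non-empty set, $(\mathcal Y,\sigma(\mathcal Y))$ a measurable space, $\Pi(\mathcal Y)$ the set of probability measures on it, $\mathcal S\subseteq\sigma(\mathcal Y)$ a non-empty collection of measurable sets, and $\mathcal H\subseteq\mathcal Y^{\mathcal X}$ a non-empty class. A (randomized) learner is a map $\mathcal A:(\mathcal X\times\mathcal S)^\star\times\mathcal X\to\Pi(\mathcal Y)$; on a stream $(x_1,S_1),\dots,(x_T,S_T)\in\mathcal X\times\mathcal S$ it draws in round $t$ a fresh label $\hat y_t\sim\mathcal A\big((x_1,S_1),\dots,(x_{t-1},S_{t-1});x_t\big)$ and suffers the loss $\mathbb 1\{\hat y_t\notin S_t\}$. Its expected regret is $$R_{\mathcal A}(T,\mathcal H)=\sup_{(x_1,S_1),\dots,(x_T,S_T)}\mathbb E\Big[\sum_{t=1}^T\mathbb 1\{\hat y_t\notin S_t\}-\inf_{h\in\mathcal H}\sum_{t=1}^T\mathbb 1\{h(x_t)\notin S_t\}\Big].$$ $\mathcal H$ is *agnostically online learnable* if there is a learner $\mathcal A$ (not depending on $T$) such that $T\mapsto R_{\mathcal A}(T,\mathcal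 H)$ is non-decreasing and $R_{\mathcal A}(T,\mathcal H)/T\to0$. For a set $M$, an $M$-ary tree of depth $d$ labels its nodes by maps $\mathcal T_t:M^{t-1}\to\mathcal X$ and its edges by maps $f_t:M^t\to\mathcal S$ ($1\le t\le d$); say that its paths are realized by $\mathcal H$ if for every $m\in M^d$ there is $h\in\mathcal H$ with $h(\mathcal T_t(m_{<t}))\in f_t(m_{\le t})$ for all $t\le d$. $\mathrm{SL}_2(\mathcal H)\in\mathbb N\cup\{\infty\}$ is the supremum of the depths $d$ of $\{1,2\}$-ary trees whose paths are realized by $\mathcal H$ and for which $f_t(m_{<t},1)\cap f_t(m_{<t},2)=\emptyset$ at every node. For $\gamma\in(0,1]$, $\mathrm{MS}_\gamma(\mathcal H)\in\mathbb N\cup\{\infty\}$ is the supremum of the depths $d$ of $\Pi(\mathcal Y)$-ary trees whose paths are realized by $\mathcal H$ and for which $\mu_t(f_t(\mu_{\le t}))\le1-\gamma$ for all $(\mu_1,\dots,\mu_d)\in\Pi(\mathcal Y)^d$ and $t\le d$. Put $$L(T)=\max\Big\{\sqrt{\tfrac{\min(\mathrm{SL}_2(\mathcal H),T)\,T}{8}},\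 \sup_{\gamma\in(0,1]}\gamma\min(\mathrm{MS}_\gamma(\mathcal H),T)\Big\},$$ $$U(T)=\inf_{\gamma\in(0,1]}\Big\{\mathrm{MS}_\gamma(\mathcal H)+\gamma T+\sqrt{2\,\mathrm{MS}_\gamma(\mathcal H)\,T\ln T}\Big\},$$ where for $T=0$ the term under the root in $U$ is read with $\ln 0=0$ and $0\cdot\infty=0$. (If $T\ge\mathrm{SL}_2(\mathcal H)$ and $T\ge\mathrm{MS}_\gamma(\mathcal H)$ for all $\gamma$, the minima with $T$ disappear.) **Theorem (Agnostic learnability).** For all $\mathcal X,\mathcal Y,\mathcal S,\mathcal H$ as above: 1. If $\mathrm{MS}_\gamma(\mathcal H)>0$ for some $\gamma\in(0,1]$, then $L(T)\le\inf_{\mathcal A}R_{\mathcal A}(T,\mathcal H)$ for all $T\ge 0$. 2. $\inf_{\mathcal A}R_{\mathcal A}(T,\mathcal H)\le U(T)$ for all $T\ge 0$. 3. $\mathcal H$ is agnostically online learnable if and only if $\mathrm{MS}_\gamma(\mathcal H)<\infty$ for every $\gamma\in(0,1]$. Moreover the bounds can be tight: 4. There are $\mathcal X,\mathcal Y,\mathcal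 S,\mathcal H$ with $\mathrm{SL}_2(\mathcal H)=0$ and $\inf_{\mathcal A}R_{\mathcal A}(T,\mathcal H)=L(T)>0$ for all $T\ge1$. 5. There are $\mathcal X,\mathcal Y,\mathcal S,\mathcal H$ with $\inf_{\mathcal A}R_{\mathcal A}(T,\mathcal H)=U(T)>0$ for all $T\ge1$. 6. For every $d\ge1$ there are $\mathcal X,\mathcal Y,\mathcal H$ and $\mathcal S=\{\{y\}:y\in\mathcal Y\}$ (all singletons measurable) with $\mathrm{SL}_2(\mathcal H)=d$ and $\mathrm{MS}_\gamma(\mathcal H)=d$ for all $\gamma\in(0,\frac12]$, such that $\inf_{\mathcal A}R_{\mathcal A}(T,\mathcal H)\le 2L(T)$ for all $T\ge 0$ and $U(T)\le 8\sqrt{\ln T}\,\inf_{\mathcal A}R_{\mathcal A}(T,\mathcal H)$ for all $T\ge2$. Finally, when $\mathrm{MS}_\gamma$ vanishes at every scale there is no non-negative lower bound: 7. There are $\mathcal X,\mathcal Y,\mathcal S,\mathcal H$ with $\mathrm{MS}_\gamma(\mathcal H)=0$ for all $\gamma\in(0,1]$ and $\inf_{\mathcal A}R_{\mathcal A}(T,\mathcal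 H)=-T$ for all $T\ge 0$. -/

import Mathlib

open Set Filter Topology MeasureTheory
open scoped ENNReal

noncomputable section

namespace SetFeedback

universe u v w

/-! ### The online game with set-valued feedback -/

/-- A randomized online learner: a deterministic map from the finite list of past labelled examples
(oldest first) and the new instance to a probability measure on the label space. -/
def Learner (X : Type u) {Y : Type v} [MeasurableSpace Y] (𝒮 : Set (Set Y)) : Type (max u v) :=
  List (X × 𝒮) → X → ProbabilityMeasure Y

/-- The loss `1{y ∉ S}`. -/
def setLoss {Y : Type v} (S : Set Y) (y : Y) : ℝ :=
  Sᶜ.indicator (fun _ => (1 : ℝ)) y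

section Game

variable {X : Type u} {Y : Type v} [MeasurableSpace Y] {𝒮 : Set (Set Y)}

/-- The examples revealed strictly before round `t`, oldest first. -/
def history {T : ℕ} (s : Fin T → X × 𝒮) (t : Fin T) : List (X × 𝒮) :=
  List.ofFn fun i : Fin t.val => s ⟨i.val, i.isLt.trans t.isLt⟩

/-- The distribution from which the learner draws its prediction in round `t` on the stream `s`. -/
def Learner.law (A : Learner X 𝒮) {T : ℕ} (s : Fin T → X × 𝒮) (t : Fin T) :
    ProbabilityMeasure Y :=
  A (history s t) (s t).1

/-- The joint law of the predictions `ŷ₁, …, ŷ_T` on a fixed stream: in round `t` the learner draws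
`ŷ_t` freshly from its current distribution, which depends on the stream only. -/
def Learner.jointLaw (A : Learner X 𝒮) {T : ℕ} (s : Fin T → X × 𝒮) : Measure (Fin T → Y) :=
  Measure.pi fun t => (A.law s t : Measure Y)

/-- The cumulative loss on the stream `s` of the best fixed hypothesis in hindsight. -/
def bestLoss (H : Set (X → Y)) {T : ℕ} (s : Fin T → X × 𝒮) : ℝ :=
  ⨅ h : H, ∑ t : Fin T, setLoss (s t).2.1 (h.1 (s t).1)

/-- The expected regret of `A` on the stream `s`. -/
def Learner.streamRegret (A : Learner X 𝒮) (H : Set (X → Y)) {T : ℕ} (s : Fin T → X × 𝒮) : ℝ :=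
  ∫ y : Fin T → Y, ((∑ t : Fin T, setLoss (s t).2.1 (y t)) - bestLoss H s) ∂(A.jointLaw s)

/-- The worst-case expected regret `R_A(T, H)`. -/
def Learner.regret (A : Learner X 𝒮) (H : Set (X → Y)) (T : ℕ) : EReal :=
  ⨆ s : Fin T → X × 𝒮, ((A.streamRegret H s : ℝ) : EReal)

variable (𝒮) in
/-- The minimax expected regret `inf_A R_A(T, H)`. -/
def minimaxRegret (H : Set (X → Y)) (T : ℕ) : EReal :=
  ⨅ A : Learner X 𝒮, A.regret H T

variable (𝒮) in
/-- Agnostic online learnability: a single learner whose expected regret is a non-decreasing and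
sublinear function of the horizon. -/
def AgnosticLearnable (H : Set (X → Y)) : Prop :=
  ∃ A : Learner X 𝒮, Monotone (A.regret H) ∧
    Tendsto (fun T : ℕ => A.regret H T / (T : EReal)) atTop (𝓝 0)

end Game

/-! ### Trees and dimensions -/

/-- An `X`-valued, `M`-ary tree with edges labelled by members of `𝒮`.  A node is addressed by the
word of edge indices leading to it from the root, and an edge by the word that ends with its own
index.  In a tree of depth `d` only the nodes at words of length `< d` and the edges at
non-empty words of length `≤ d` are used. -/
structure EdgeTree (X : Type u) (M : Type w) {Y : Type v} (𝒮 : Set (Set Y)) where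
  node : List M → X
  edge : List M → 𝒮

section Dimensions

variable {X : Type u} {M : Type w} {Y : Type v} {𝒮 : Set (Set Y)}

/-- Along every path `q = (q₁, …, q_d)` some hypothesis in `H` takes values in all the sets that
label the edges of the path. -/
def EdgeTree.PathsRealizedBy (τ : EdgeTree X M 𝒮) (H : Set (X → Y)) (d : ℕ) : Prop :=
  ∀ q : List M, q.length = d →
    ∃ h ∈ H, ∀ t < d, h (τ.node (q.take t)) ∈ (τ.edge (q.take (t + 1))).1

variable (𝒮) in
/-- There is a `[p]`-ary tree of depth `d` shattered by `H`: moreover at every internal node the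
`p` sets that label the outgoing edges have empty intersection. -/
def SLShatters (p : ℕ) (H : Set (X → Y)) (d : ℕ) : Prop :=
  ∃ τ : EdgeTree X (Fin p) 𝒮, τ.PathsRealizedBy H d ∧
    ∀ q : List (Fin p), q.length = d → ∀ t < d, (⋂ i : Fin p, (τ.edge (q.take t ++ [i])).1) = ∅

variable (𝒮) in
/-- The `p`-Set Littlestone dimension `SL_p(H)`. -/
def slDim (p : ℕ) (H : Set (X → Y)) : ℕ∞ :=
  ⨆ (d : ℕ) (_ : SLShatters 𝒮 p H d), (d : ℕ∞)

variable (𝒮) in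
/-- There is a `Π(Y)`-ary tree of depth `d` which is `γ`-shattered by `H`: moreover every edge
indexed by a measure `μ` is labelled by a set of `μ`-measure at most `1 - γ`. -/
def MSShatters [MeasurableSpace Y] (γ : ℝ) (H : Set (X → Y)) (d : ℕ) : Prop :=
  ∃ τ : EdgeTree X (ProbabilityMeasure Y) 𝒮, τ.PathsRealizedBy H d ∧
    ∀ q : List (ProbabilityMeasure Y), q.length = d → ∀ (t : ℕ) (ht : t < q.length),
      (q[t] : Measure Y).real (τ.edge (q.take (t + 1))).1 ≤ 1 - γ

variable (𝒮) in
/-- The Measure Shattering dimension `MS_γ(H)` at scale `γ`. -/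
def msDim [MeasurableSpace Y] (γ : ℝ) (H : Set (X → Y)) : ℕ∞ :=
  ⨆ (d : ℕ) (_ : MSShatters 𝒮 γ H d), (d : ℕ∞)

variable (𝒮) in
/-- `max {√(min(SL₂, T) T / 8), sup_γ γ min(MS_γ, T)}`. -/
def lowerBound [MeasurableSpace Y] (H : Set (X → Y)) (T : ℕ) : ℝ≥0∞ :=
  max ((((min (slDim 𝒮 2 H) T : ℕ∞) : ℝ≥0∞) * T / 8) ^ (1 / 2 : ℝ))
    (⨆ γ ∈ Ioc (0 : ℝ) 1, ENNReal.ofReal γ * ((min (msDim 𝒮 γ H) T : ℕ∞) : ℝ≥0∞))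

variable (𝒮) in
/-- `inf_γ {MS_γ + γ T + √(2 MS_γ T ln T)}`. -/
def upperBound [MeasurableSpace Y] (H : Set (X → Y)) (T : ℕ) : ℝ≥0∞ :=
  ⨅ γ ∈ Ioc (0 : ℝ) 1, ((msDim 𝒮 γ H : ℝ≥0∞) + ENNReal.ofReal (γ * T) +
    (2 * (msDim 𝒮 γ H : ℝ≥0∞) * T * ENNReal.ofReal (Real.log T)) ^ (1 / 2 : ℝ))

end Dimensions

end SetFeedback

end

noncomputable section

namespace SetFeedback

universe u v w

/-! ### Losses of hypotheses and the best loss in hindsight -/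

section Hypotheses

variable {X : Type u} {Y : Type v} {𝒮 : Set (Set Y)}

/-! Labels are drawn afresh from measures that depend on the stream only, so the expected loss is
the sum of `1 - μ_t(S_t)`: the game becomes deterministic, with measures as moves
(`Learner.streamRegret_eq`).

Lower bounds. In a `γ`-shattered tree the adversary follows the path indexed by the learner's own
predictions; the learner loses at least `γ` per round and some hypothesis loses nothing
(`MSShatters.mul_le_regret`). In a shattered binary tree of depth `d` the adversary stays at each
node for a block of about `T / d` rounds and reveals one of the two disjoint sets in each. Against a
fair coin any prediction loses at least one half on average, while a hypothesis consistent with the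
more frequent set gains half the distance of a simple random walk from its start; the adversary
derandomizes this and descends along that edge (`SLShatters.sqrt_le_regret`). A realizable example
makes every regret non-negative and monotone, which carries bounds from short horizons to longer
ones.

Upper bound. If `V` is not `γ`-shattered at depth `k + 1`, some measure `μ` has the property that
restricting `V` by any set of `μ`-measure at most `1 - γ` leaves a class not shattered at depth `k`;
otherwise the subtrees could be glued. For a fixed comparator, updating the version space only when
the comparator is right and the prediction is poor takes at most `MS_γ` updates. The right update
rounds are unknown, so exponential weights compete with all choices of them
(`exists_agnostic_learner`). Restarting near-minimax learners on blocks of growing length removes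
the dependence on the horizon; conversely infinite `MS_γ` forces regret `γ T`.

Examples. For cofinite feedback on `ℕ`, `MS_γ` is infinite below scale one and zero at scale one, so
both bounds equal `T`. The Boolean cube has both dimensions equal to `d`, and Hedge over its `2 ^ d`
points gives the rate. A single hypothesis that is never correct gives regret `-T`. -/

theorem setLoss_of_mem {S : Set Y} {y : Y} (h : y ∈ S) : setLoss S y = 0 := by
  simp [setLoss, h]

theorem setLoss_of_notMem {S : Set Y} {y : Y} (h : y ∉ S) : setLoss S y = 1 := by
  simp [setLoss, h]

theorem setLoss_nonneg (S : Set Y) (y : Y) : 0 ≤ setLoss S y := by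
  by_cases h : y ∈ S
  · rw [setLoss_of_mem h]
  · rw [setLoss_of_notMem h]; exact zero_le_one

theorem setLoss_le_one (S : Set Y) (y : Y) : setLoss S y ≤ 1 := by
  by_cases h : y ∈ S
  · rw [setLoss_of_mem h]; exact zero_le_one
  · rw [setLoss_of_notMem h]

/-- The cumulative loss of a hypothesis on a list of examples. -/
def hypLoss (h : X → Y) (l : List (X × 𝒮)) : ℝ :=
  (l.map fun p => setLoss p.2.1 (h p.1)).sum

theorem hypLoss_append (h : X → Y) (l l' : List (X × 𝒮)) :
    hypLoss h (l ++ l') = hypLoss h l + hypLoss h l' := by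
  simp [hypLoss]

theorem hypLoss_cons (h : X → Y) (p : X × 𝒮) (l : List (X × 𝒮)) :
    hypLoss h (p :: l) = setLoss p.2.1 (h p.1) + hypLoss h l := by
  simp [hypLoss]

theorem hypLoss_singleton (h : X → Y) (p : X × 𝒮) :
    hypLoss h [p] = setLoss p.2.1 (h p.1) := by
  simp [hypLoss]

theorem hypLoss_nonneg (h : X → Y) (l : List (X × 𝒮)) : 0 ≤ hypLoss h l := by
  induction l with
  | nil => simp [hypLoss]
  | cons p l ih => rw [hypLoss_cons]; exact add_nonneg (setLoss_nonneg _ _) ih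

theorem hypLoss_eq_zero {h : X → Y} {l : List (X × 𝒮)} (H : ∀ p ∈ l, h p.1 ∈ p.2.1) :
    hypLoss h l = 0 := by
  induction l with
  | nil => rfl
  | cons p l ih =>
    rw [hypLoss_cons, setLoss_of_mem (H p (by simp)), ih fun q hq => H q (by simp [hq]), add_zero]

theorem hypLoss_eq_length {h : X → Y} {l : List (X × 𝒮)} (H : ∀ p ∈ l, h p.1 ∉ p.2.1) :
    hypLoss h l = l.length := by
  induction l with
  | nil => simp [hypLoss]
  | cons p l ih =>
    rw [hypLoss_cons, setLoss_of_notMem (H p (by simp)), ih fun q hq => H q (by simp [hq])]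
    simp [add_comm]

/-- The loss on the list `l` of the best hypothesis in hindsight. -/
def bestListLoss (H : Set (X → Y)) (l : List (X × 𝒮)) : ℝ :=
  ⨅ h : H, hypLoss h.1 l

theorem bestListLoss_le {H : Set (X → Y)} {h : X → Y} (hh : h ∈ H) (l : List (X × 𝒮)) :
    bestListLoss H l ≤ hypLoss h l :=
  ciInf_le (f := fun h : H => hypLoss h.1 l)
    ⟨0, by rintro _ ⟨h, rfl⟩; exact hypLoss_nonneg _ _⟩ ⟨h, hh⟩

/-- Losses count mistakes, so they are natural numbers and the infimum is attained even over an
infinite class. -/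
theorem exists_hypLoss_eq_bestListLoss {H : Set (X → Y)} (hH : H.Nonempty) (l : List (X × 𝒮)) :
    ∃ h ∈ H, hypLoss h l = bestListLoss H l := by
  classical
  have key : ∀ h : X → Y, hypLoss h l = ((l.countP fun p => h p.1 ∉ p.2.1 : ℕ) : ℝ) := by
    intro h
    induction l with
    | nil => simp [hypLoss]
    | cons p l ih =>
      rw [hypLoss_cons, ih, List.countP_cons]
      by_cases hp : h p.1 ∈ p.2.1
      · simp [setLoss_of_mem hp, hp]
      · simp [setLoss_of_notMem hp, hp, add_comm]
  obtain ⟨h, hh, hmin⟩ := WellFounded.has_min (InvImage.wf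
    (fun h : X → Y => l.countP fun p => h p.1 ∉ p.2.1) wellFounded_lt) H hH
  refine ⟨h, hh, le_antisymm ?_ (bestListLoss_le hh l)⟩
  have : Nonempty H := ⟨⟨h, hh⟩⟩
  refine le_ciInf fun g => ?_
  rw [key, key]
  exact_mod_cast not_lt.1 (hmin g.1 g.2)

theorem history_succ {T : ℕ} (s : Fin (T + 1) → X × 𝒮) (t : Fin T) :
    history s t.succ = s 0 :: history (fun i => s i.succ) t := by
  simp only [history]
  exact List.ofFn_succ

end Hypotheses

/-! ### The deterministic form of the game -/

section Streams

variable {X : Type u} {Y : Type v} [MeasurableSpace Y] {𝒮 : Set (Set Y)}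

/-- The expected loss of the learner in one round, given the past `pre` and the new example `p`. -/
def Learner.roundLoss (A : Learner X 𝒮) (pre : List (X × 𝒮)) (p : X × 𝒮) : ℝ :=
  1 - (A pre p.1 : Measure Y).real p.2.1

/-- The expected cumulative loss of the learner on the examples `l`, revealed after `pre`. -/
def Learner.cumLoss (A : Learner X 𝒮) : List (X × 𝒮) → List (X × 𝒮) → ℝ
  | _, [] => 0
  | pre, p :: l => A.roundLoss pre p + A.cumLoss (pre ++ [p]) l

namespace Learner

variable (A : Learner X 𝒮)

theorem roundLoss_nonneg (pre : List (X × 𝒮)) (p : X × 𝒮) : 0 ≤ A.roundLoss pre p :=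
  sub_nonneg.2 measureReal_le_one

theorem roundLoss_le_one (pre : List (X × 𝒮)) (p : X × 𝒮) : A.roundLoss pre p ≤ 1 :=
  sub_le_self _ measureReal_nonneg

theorem cumLoss_append (pre l l' : List (X × 𝒮)) :
    A.cumLoss pre (l ++ l') = A.cumLoss pre l + A.cumLoss (pre ++ l) l' := by
  induction l generalizing pre with
  | nil => simp [cumLoss]
  | cons p l ih => simp [cumLoss, ih, add_assoc]

theorem cumLoss_concat (l : List (X × 𝒮)) (p : X × 𝒮) :
    A.cumLoss [] (l ++ [p]) = A.cumLoss [] l + A.roundLoss l p := by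
  simp [cumLoss_append, cumLoss]

theorem cumLoss_nonneg (pre l : List (X × 𝒮)) : 0 ≤ A.cumLoss pre l := by
  induction l generalizing pre with
  | nil => exact le_rfl
  | cons p l ih => exact add_nonneg (A.roundLoss_nonneg _ _) (ih _)

theorem cumLoss_le_length (pre l : List (X × 𝒮)) : A.cumLoss pre l ≤ l.length := by
  induction l generalizing pre with
  | nil => simp [cumLoss]
  | cons p l ih =>
    have h1 := A.roundLoss_le_one pre p
    have h2 := ih (pre ++ [p])
    simp only [cumLoss, List.length_cons, Nat.cast_add, Nat.cast_one]
    linarith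

/-- The cumulative loss only depends on the predictions made along the way. -/
theorem cumLoss_congr {A B : Learner X 𝒮} {pre pre' l : List (X × 𝒮)}
    (h : ∀ l₁ p l₂, l = l₁ ++ p :: l₂ → A (pre ++ l₁) p.1 = B (pre' ++ l₁) p.1) :
    A.cumLoss pre l = B.cumLoss pre' l := by
  induction l generalizing pre pre' with
  | nil => rfl
  | cons p l ih =>
    have h0 := h [] p l rfl
    simp only [List.append_nil] at h0
    simp only [cumLoss, roundLoss, h0]
    congr 1
    refine ih fun l₁ q l₂ hl => ?_
    have := h (p :: l₁) q l₂ (by simp [hl])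
    simpa using this

theorem roundLoss_eq_setLoss (h𝒮 : ∀ S ∈ 𝒮, MeasurableSet S) {A : Learner X 𝒮}
    {pre : List (X × 𝒮)} {p : X × 𝒮} {y : Y} (h : A pre p.1 = diracProba y) :
    A.roundLoss pre p = setLoss p.2.1 y := by
  have hy : (A pre p.1 : Measure Y).real p.2.1 = p.2.1.indicator (fun _ => (1 : ℝ)) y := by
    rw [h, measureReal_def]
    change ((Measure.dirac y) p.2.1).toReal = _
    rw [Measure.dirac_apply' _ (h𝒮 _ p.2.2)]
    by_cases hp : y ∈ p.2.1 <;> simp [hp]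
  rw [roundLoss, hy]
  by_cases hp : y ∈ p.2.1
  · simp [setLoss_of_mem hp, hp]
  · simp [setLoss_of_notMem hp, hp]

/-- The learner that always predicts with the hypothesis `h`. -/
def ofHyp (𝒮 : Set (Set Y)) (h : X → Y) : Learner X 𝒮 := fun _ x => diracProba (h x)

theorem cumLoss_ofHyp (h𝒮 : ∀ S ∈ 𝒮, MeasurableSet S) (h : X → Y) (pre l : List (X × 𝒮)) :
    (ofHyp 𝒮 h).cumLoss pre l = hypLoss h l := by
  induction l generalizing pre with
  | nil => rfl
  | cons p l ih => rw [cumLoss, ih, hypLoss_cons, roundLoss_eq_setLoss h𝒮 rfl]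

theorem sum_roundLoss {T : ℕ} (s : Fin T → X × 𝒮) (pre : List (X × 𝒮)) :
    ∑ t, A.roundLoss (pre ++ history s t) (s t) = A.cumLoss pre (List.ofFn s) := by
  induction T generalizing pre with
  | zero => simp [cumLoss]
  | succ T ih =>
    rw [Fin.sum_univ_succ, List.ofFn_succ, cumLoss, ← ih]
    have h0 : history s 0 = [] := by simp [history]
    simp [h0, history_succ]

/-- By linearity of expectation only the marginals of the product law matter, and the comparator
term is constant in the predictions. -/
theorem streamRegret_eq (h𝒮 : ∀ S ∈ 𝒮, MeasurableSet S) (H : Set (X → Y)) {T : ℕ}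
    (s : Fin T → X × 𝒮) :
    A.streamRegret H s = A.cumLoss [] (List.ofFn s) - bestListLoss H (List.ofFn s) := by
  have hbest : bestLoss H s = bestListLoss H (List.ofFn s) := by
    simp only [bestLoss, bestListLoss, hypLoss, List.map_ofFn, List.sum_ofFn, Function.comp]
  have : ∀ t, IsProbabilityMeasure (A.law s t : Measure Y) := fun t => inferInstance
  have hP : IsProbabilityMeasure (A.jointLaw s) := by
    unfold jointLaw; infer_instance
  have hmeas : ∀ t : Fin T, Measurable fun y : Y => setLoss (s t).2.1 y := fun t =>
    measurable_const.indicator (h𝒮 _ (s t).2.2).compl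
  have hint : ∀ t : Fin T, Integrable (fun y : Fin T → Y => setLoss (s t).2.1 (y t))
      (A.jointLaw s) := fun t =>
    Integrable.of_bound ((hmeas t).comp (measurable_pi_apply t)).aestronglyMeasurable 1
      (Eventually.of_forall fun y => by
        rw [Real.norm_of_nonneg (setLoss_nonneg _ _)]; exact setLoss_le_one _ _)
  have hval : ∀ t : Fin T, ∫ y, setLoss (s t).2.1 (y t) ∂(A.jointLaw s) =
      A.roundLoss ([] ++ history s t) (s t) := by
    intro t
    have hp : MeasurePreserving (Function.eval t) (A.jointLaw s) (A.law s t : Measure Y) :=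
      measurePreserving_eval _ t
    have h1 : ∫ y, setLoss (s t).2.1 (y t) ∂(A.jointLaw s) =
        ∫ y, setLoss (s t).2.1 y ∂(A.law s t : Measure Y) := by
      rw [← hp.map_eq, integral_map hp.measurable.aemeasurable
        (hmeas t).aestronglyMeasurable]
    rw [h1]
    simp only [setLoss]
    rw [integral_indicator_const _ (h𝒮 _ (s t).2.2).compl,
      probReal_compl_eq_one_sub (h𝒮 _ (s t).2.2)]
    simp [roundLoss, law]
  rw [streamRegret, integral_sub (integrable_finsetSum _ fun t _ => hint t) (integrable_const _),
    integral_finsetSum _ fun t _ => hint t, integral_const, hbest, ← A.sum_roundLoss s []]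
  simp [hval]

theorem le_regret (h𝒮 : ∀ S ∈ 𝒮, MeasurableSet S) (H : Set (X → Y)) (l : List (X × 𝒮)) :
    ((A.cumLoss [] l - bestListLoss H l : ℝ) : EReal) ≤ A.regret H l.length := by
  have h := le_iSup (fun s : Fin l.length → X × 𝒮 => ((A.streamRegret H s : ℝ) : EReal)) l.get
  simp only [A.streamRegret_eq h𝒮, List.ofFn_get] at h
  refine h.trans (iSup_mono fun s => ?_)
  rw [A.streamRegret_eq h𝒮]

theorem regret_le (h𝒮 : ∀ S ∈ 𝒮, MeasurableSet S) (H : Set (X → Y)) {T : ℕ} {B : EReal}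
    (h : ∀ l : List (X × 𝒮), l.length = T →
      ((A.cumLoss [] l - bestListLoss H l : ℝ) : EReal) ≤ B) : A.regret H T ≤ B := by
  refine iSup_le fun s => ?_
  rw [A.streamRegret_eq h𝒮]
  exact h _ (by simp)

theorem regret_le_of_forall (h𝒮 : ∀ S ∈ 𝒮, MeasurableSet S) {H : Set (X → Y)} (hH : H.Nonempty)
    {T : ℕ} {B : ℝ} (h : ∀ l : List (X × 𝒮), l.length = T → ∀ g ∈ H,
      A.cumLoss [] l ≤ hypLoss g l + B) : A.regret H T ≤ (B : EReal) := by
  refine A.regret_le h𝒮 H fun l hl => EReal.coe_le_coe_iff.2 ?_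
  obtain ⟨g, hg, hgl⟩ := exists_hypLoss_eq_bestListLoss hH l
  have := h l hl g hg
  linarith

theorem le_regret_of_hypLoss (h𝒮 : ∀ S ∈ 𝒮, MeasurableSet S) {H : Set (X → Y)} {l : List (X × 𝒮)}
    {h : X → Y} (hh : h ∈ H) {B : ℝ} (hB : B ≤ A.cumLoss [] l - hypLoss h l) :
    (B : EReal) ≤ A.regret H l.length :=
  (EReal.coe_le_coe_iff.2 (hB.trans (sub_le_sub_left (bestListLoss_le hh l) _))).trans
    (A.le_regret h𝒮 H l)

theorem regret_le_horizon (h𝒮 : ∀ S ∈ 𝒮, MeasurableSet S) {H : Set (X → Y)} (hH : H.Nonempty)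
    (T : ℕ) : A.regret H T ≤ (T : EReal) := by
  refine (A.regret_le_of_forall h𝒮 hH (B := T) fun l hl g _ => ?_).trans_eq (by simp)
  have h1 := A.cumLoss_le_length [] l
  have h2 := hypLoss_nonneg g l
  rw [hl] at h1
  linarith

theorem regret_nonneg (h𝒮 : ∀ S ∈ 𝒮, MeasurableSet S) {H : Set (X → Y)}
    {h : X → Y} (hh : h ∈ H) {p : X × 𝒮} (hp : h p.1 ∈ p.2.1) (T : ℕ) : 0 ≤ A.regret H T := by
  have := A.le_regret_of_hypLoss h𝒮 hh (l := List.replicate T p) (B := 0) (by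
    rw [hypLoss_eq_zero fun q hq => by rwa [List.eq_of_mem_replicate hq], sub_zero]
    exact A.cumLoss_nonneg _ _)
  simpa using this

/-- As soon as some example is realizable, the regret of every learner is monotone: the best
hypothesis in hindsight can be kept correct by repeating an example on which it is correct. -/
theorem regret_monotone (h𝒮 : ∀ S ∈ 𝒮, MeasurableSet S) {H : Set (X → Y)}
    {h : X → Y} (hh : h ∈ H) {p : X × 𝒮} (hp : h p.1 ∈ p.2.1) : Monotone (A.regret H) := by
  refine monotone_nat_of_le_succ fun T => A.regret_le h𝒮 H fun l hl => ?_
  obtain ⟨g, hg, hgl⟩ := exists_hypLoss_eq_bestListLoss ⟨h, hh⟩ l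
  -- If the best hypothesis is right somewhere on the stream, that example is repeated. Otherwise
  -- its loss is the full length, so the regret on the stream is at most zero.
  by_cases hex : ∃ q ∈ l, g q.1 ∈ q.2.1
  · obtain ⟨q, -, hq⟩ := hex
    have := A.le_regret_of_hypLoss h𝒮 hg (l := l ++ [q]) (B := A.cumLoss [] l - bestListLoss H l)
      (by
        rw [hypLoss_append, hypLoss_singleton, setLoss_of_mem hq, A.cumLoss_concat, hgl]
        linarith [A.roundLoss_nonneg l q])
    simpa [hl] using this
  · push Not at hex
    have h1 := A.cumLoss_le_length [] l
    have h2 := hypLoss_eq_length hex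
    refine le_trans ?_ (A.regret_nonneg h𝒮 hh hp (T + 1))
    exact_mod_cast (by linarith : A.cumLoss [] l - bestListLoss H l ≤ 0)

end Learner

end Streams

/-! ### Absolute moments of the simple random walk -/

section RandomWalk

/-- The mean of `|z + Sₙ|` for a simple random walk `Sₙ`. -/
def walkAbs : ℕ → ℤ → ℝ
  | 0, z => |(z : ℝ)|
  | n + 1, z => (walkAbs n (z + 1) + walkAbs n (z - 1)) / 2

/-- The probability that a simple random walk started at `z` is at `0` at time `n`. -/
def walkZero : ℕ → ℤ → ℝ
  | 0, z => if z = 0 then 1 else 0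
  | n + 1, z => (walkZero n (z + 1) + walkZero n (z - 1)) / 2

/-- Discrete Tanaka formula: averaging `|·|` over the two neighbours of `z` changes it only at `z =
0`, where it adds one; both recursions propagate this linearly. -/
theorem walkAbs_succ (n : ℕ) (z : ℤ) : walkAbs (n + 1) z = walkAbs n z + walkZero n z := by
  induction n generalizing z with
  | zero =>
    simp only [walkAbs, walkZero]
    rcases lt_trichotomy z 0 with h | h | h
    · have h1 : (z : ℝ) + 1 ≤ 0 := by exact_mod_cast h
      rw [if_neg h.ne]
      push_cast
      rw [abs_of_nonpos h1, abs_of_nonpos (by linarith), abs_of_nonpos (by linarith)]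
      ring
    · subst h
      norm_num
    · have h1 : (1 : ℝ) ≤ z := by exact_mod_cast h
      rw [if_neg h.ne']
      push_cast
      rw [abs_of_nonneg (by linarith), abs_of_nonneg (by linarith), abs_of_nonneg (by linarith)]
      ring
  | succ n ih =>
    rw [walkAbs, ih, ih]
    simp only [walkAbs, walkZero]
    ring

theorem walkZero_of_lt {n : ℕ} {z : ℤ} (h : (n : ℤ) < |z|) : walkZero n z = 0 := by
  induction n generalizing z with
  | zero => rw [walkZero, if_neg]; rintro rfl; simp at h
  | succ n ih =>
    rw [walkZero, ih, ih]
    · norm_num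
    all_goals push_cast at h; grind

theorem walkZero_of_odd {n : ℕ} {z : ℤ} (h : Odd (n + z)) : walkZero n z = 0 := by
  induction n generalizing z with
  | zero => rw [walkZero, if_neg]; rintro rfl; simp at h
  | succ n ih =>
    rw [walkZero, ih, ih]
    · norm_num
    all_goals push_cast at h; grind

theorem walkZero_eq_choose (n i : ℕ) :
    walkZero n (n - 2 * i) = (n.choose i : ℝ) / 2 ^ n := by
  induction n generalizing i with
  | zero =>
    rcases Nat.eq_zero_or_pos i with rfl | hi
    · simp [walkZero]
    · rw [Nat.choose_eq_zero_of_lt hi]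
      simp [walkZero, hi.ne']
  | succ n ih =>
    cases i with
    | zero =>
      have h1 := ih 0
      rw [walkZero, walkZero_of_lt (z := ((n + 1 : ℕ) : ℤ) - 2 * (0 : ℕ) + 1) (by push_cast; grind)]
      have e : ((n + 1 : ℕ) : ℤ) - 2 * (0 : ℕ) - 1 = n - 2 * (0 : ℕ) := by push_cast; ring
      rw [e, h1]
      simp [pow_succ]
      ring
    | succ i =>
      have e1 : ((n + 1 : ℕ) : ℤ) - 2 * (i + 1 : ℕ) + 1 = n - 2 * (i : ℕ) := by push_cast; ring
      have e2 : ((n + 1 : ℕ) : ℤ) - 2 * (i + 1 : ℕ) - 1 = n - 2 * (i + 1 : ℕ) := by push_cast; ring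
      rw [walkZero, e1, e2, ih, ih, Nat.choose_succ_succ]
      push_cast
      ring

/-- The return probability `C(2j, j) / 4 ^ j` of the simple random walk. -/
def returnProb (j : ℕ) : ℝ := walkZero (2 * j) 0

theorem returnProb_eq (j : ℕ) : returnProb j = (j.centralBinom : ℝ) / 4 ^ j := by
  have h := walkZero_eq_choose (2 * j) j
  rw [show (((2 * j : ℕ) : ℤ) - 2 * (j : ℕ)) = 0 by push_cast; ring, pow_mul] at h
  rw [returnProb, h, Nat.centralBinom]
  norm_num

theorem returnProb_succ (j : ℕ) :
    (2 * j + 2) * returnProb (j + 1) = (2 * j + 1) * returnProb j := by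
  have h : ((j : ℝ) + 1) * (j + 1).centralBinom = 2 * (2 * j + 1) * j.centralBinom := by
    exact_mod_cast Nat.succ_mul_centralBinom_succ j
  rw [returnProb_eq, returnProb_eq, pow_succ]
  field_simp
  linarith

theorem returnProb_pos (j : ℕ) : 0 < returnProb j := by
  rw [returnProb_eq]
  have := Nat.centralBinom_pos j
  positivity

/-- The quantity increases with `j`, by the factor `(2j + 1)² / (4j(j + 1))`, and equals one at `j =
1`. -/
theorem one_le_four_mul_returnProb_sq {j : ℕ} (hj : 1 ≤ j) : 1 ≤ 4 * j * returnProb j ^ 2 := by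
  induction j, hj using Nat.le_induction with
  | base => rw [returnProb_eq]; norm_num [Nat.centralBinom, Nat.choose]
  | succ j hj ih =>
    have h := returnProb_succ j
    have hj0 : (0 : ℝ) < j := by exact_mod_cast hj
    have h2 : (2 * (j : ℝ) + 2) ^ 2 * returnProb (j + 1) ^ 2 =
        (2 * j + 1) ^ 2 * returnProb j ^ 2 := by rw [← mul_pow, h, mul_pow]
    have h3 : j * (4 * ((j : ℝ) + 1) * returnProb (j + 1) ^ 2 * (j + 1)) =
        (2 * j + 1) ^ 2 / 4 * (4 * j * returnProb j ^ 2) := by linear_combination j * h2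
    have h4 : (j : ℝ) * (j + 1) ≤ (2 * j + 1) ^ 2 / 4 * (4 * j * returnProb j ^ 2) := by
      nlinarith [sq_nonneg (2 * (j : ℝ) + 1)]
    rw [← h3] at h4
    have h5 := le_of_mul_le_mul_left h4 hj0
    push_cast
    exact le_of_mul_le_mul_right (by linarith) (by positivity : (0 : ℝ) < j + 1)

theorem walkAbs_even (j : ℕ) : walkAbs (2 * j) 0 = 2 * j * returnProb j := by
  induction j with
  | zero => simp [walkAbs]
  | succ j ih =>
    have hodd : walkZero (2 * j + 1) 0 = 0 := walkZero_of_odd (by push_cast; simp)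
    rw [show 2 * (j + 1) = 2 * j + 1 + 1 by ring, walkAbs_succ, walkAbs_succ, hodd, ih]
    have h := returnProb_succ j
    rw [show walkZero (2 * j) 0 = returnProb j from rfl]
    push_cast
    linarith

theorem walkAbs_odd (j : ℕ) : walkAbs (2 * j + 1) 0 = (2 * j + 1) * returnProb j := by
  rw [walkAbs_succ, walkAbs_even, show walkZero (2 * j) 0 = returnProb j from rfl]
  ring

/-- Balanced blocks: with `T = d k + r`, `r < d`, split into `r` blocks of length `k + 1` and
`d - r` blocks of length `k`. -/
theorem sqrt_le_walkAbs_balanced {d k r : ℕ} (hk : 1 ≤ k) (hr : r ≤ d) :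
    √((d : ℝ) * (d * k + r) / 2) ≤ (d - r) * walkAbs k 0 + r * walkAbs (k + 1) 0 := by
  have hr' : (r : ℝ) ≤ d := by exact_mod_cast hr
  have hr0 : (0 : ℝ) ≤ r := r.cast_nonneg
  rcases Nat.even_or_odd' k with ⟨j, rfl | rfl⟩
  · have hj : 1 ≤ j := by omega
    have hc := one_le_four_mul_returnProb_sq hj
    have hcp := returnProb_pos j
    set c := returnProb j
    rw [walkAbs_even, walkAbs_odd]
    have e : ((d : ℝ) - r) * (2 * j * c) + r * ((2 * j + 1) * c) = c * (2 * j * d + r) := by ring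
    rw [e]
    refine Real.sqrt_le_iff.2 ⟨by positivity, ?_⟩
    push_cast
    have h1 : (0 : ℝ) ≤ (2 * j * d + r) := by positivity
    have h2 : (d : ℝ) / 2 ≤ c ^ 2 * (2 * j * d + r) := by nlinarith [sq_nonneg c]
    nlinarith
  · have hc := one_le_four_mul_returnProb_sq (j := j + 1) (by omega)
    have hs := returnProb_succ j
    have hcp := returnProb_pos (j + 1)
    -- An odd length and its successor have the same mean, so all `d` blocks contribute equally.
    rw [walkAbs_odd, ← hs, show 2 * j + 1 + 1 = 2 * (j + 1) by ring, walkAbs_even]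
    set c := returnProb (j + 1)
    push_cast at hc ⊢
    have e : ((d : ℝ) - r) * ((2 * j + 2) * c) + r * (2 * (j + 1) * c) = d * (2 * (j + 1) * c) := by
      ring
    rw [e]
    refine Real.sqrt_le_iff.2 ⟨by positivity, ?_⟩
    have hd0 : (0 : ℝ) ≤ d := d.cast_nonneg
    have hj0 : (0 : ℝ) ≤ j := j.cast_nonneg
    have h1 : (d : ℝ) ^ 2 * (j + 1) * 1 ≤ (d : ℝ) ^ 2 * (j + 1) * (4 * (j + 1) * c ^ 2) := by
      gcongr
    nlinarith

end RandomWalk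

/-! ### Shattered trees and the two lower bounds -/

section Truncation

variable {X : Type u} {M : Type w} {Y : Type v} {𝒮 : Set (Set Y)}

theorem EdgeTree.PathsRealizedBy.mono [Nonempty M] {τ : EdgeTree X M 𝒮} {H : Set (X → Y)}
    {d d' : ℕ} (h : τ.PathsRealizedBy H d) (hd : d' ≤ d) : τ.PathsRealizedBy H d' := by
  intro q hq
  obtain ⟨g, hg, hgq⟩ := h (q ++ List.replicate (d - d') (Classical.arbitrary M)) (by simp; omega)
  refine ⟨g, hg, fun t ht => ?_⟩
  have := hgq t (ht.trans_le hd)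
  rwa [List.take_append_of_le_length (by omega), List.take_append_of_le_length (by omega)] at this

theorem SLShatters.mono {p : ℕ} [NeZero p] {H : Set (X → Y)} {d d' : ℕ}
    (h : SLShatters 𝒮 p H d) (hd : d' ≤ d) : SLShatters 𝒮 p H d' := by
  obtain ⟨τ, hτ, hd2⟩ := h
  refine ⟨τ, hτ.mono hd, fun q hq t ht => ?_⟩
  have := hd2 (q ++ List.replicate (d - d') 0) (by simp; omega) t (ht.trans_le hd)
  rwa [List.take_append_of_le_length (by omega)] at this

/-- Shattering passes to smaller depths, so the supremum is reached at every finite depth below it.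
Depth zero is excluded because an empty supremum is also zero. -/
theorem SLShatters.of_le_slDim {p : ℕ} [NeZero p] {H : Set (X → Y)} {d : ℕ} (hd : d ≠ 0)
    (h : (d : ℕ∞) ≤ slDim 𝒮 p H) : SLShatters 𝒮 p H d := by
  obtain ⟨k, rfl⟩ := Nat.exists_eq_succ_of_ne_zero hd
  have : (k : ℕ∞) < slDim 𝒮 p H :=
    lt_of_lt_of_le (by exact_mod_cast k.lt_succ_self) h
  simp only [slDim, lt_iSup_iff] at this
  obtain ⟨n, hn, hkn⟩ := this
  exact hn.mono (by exact_mod_cast hkn)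

theorem SLShatters.le_slDim {p : ℕ} {H : Set (X → Y)} {d : ℕ}
    (h : SLShatters 𝒮 p H d) : (d : ℕ∞) ≤ slDim 𝒮 p H :=
  le_iSup₂ (f := fun (d : ℕ) (_ : SLShatters 𝒮 p H d) => (d : ℕ∞)) d h

variable [MeasurableSpace Y]

instance nonempty_probabilityMeasure [Nonempty Y] : Nonempty (ProbabilityMeasure Y) :=
  ⟨diracProba (Classical.arbitrary Y)⟩

theorem MSShatters.mono [Nonempty Y] {γ : ℝ} {H : Set (X → Y)} {d d' : ℕ}
    (h : MSShatters 𝒮 γ H d) (hd : d' ≤ d) : MSShatters 𝒮 γ H d' := by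
  obtain ⟨τ, hτ, hd2⟩ := h
  refine ⟨τ, hτ.mono hd, fun q hq t ht => ?_⟩
  have := hd2 (q ++ List.replicate (d - d') (Classical.arbitrary _)) (by simp; omega) t
    (by simp; omega)
  rwa [List.take_append_of_le_length (by omega), List.getElem_append_left ht] at this

theorem MSShatters.of_le_msDim [Nonempty Y] {γ : ℝ} {H : Set (X → Y)} {d : ℕ} (hd : d ≠ 0)
    (h : (d : ℕ∞) ≤ msDim 𝒮 γ H) : MSShatters 𝒮 γ H d := by
  obtain ⟨k, rfl⟩ := Nat.exists_eq_succ_of_ne_zero hd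
  have : (k : ℕ∞) < msDim 𝒮 γ H :=
    lt_of_lt_of_le (by exact_mod_cast k.lt_succ_self) h
  simp only [msDim, lt_iSup_iff] at this
  obtain ⟨n, hn, hkn⟩ := this
  exact hn.mono (by exact_mod_cast hkn)

theorem MSShatters.le_msDim {γ : ℝ} {H : Set (X → Y)} {d : ℕ}
    (h : MSShatters 𝒮 γ H d) : (d : ℕ∞) ≤ msDim 𝒮 γ H :=
  le_iSup₂ (f := fun (d : ℕ) (_ : MSShatters 𝒮 γ H d) => (d : ℕ∞)) d h

/-- Following the path indexed by the learner's own predictions in a shattered tree. -/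
theorem MSShatters.exists_stream {γ : ℝ} {H : Set (X → Y)} {d : ℕ} (hS : MSShatters 𝒮 γ H d)
    (A : Learner X 𝒮) : ∃ l : List (X × 𝒮), l.length = d ∧
      (∃ h ∈ H, ∀ p ∈ l, h p.1 ∈ p.2.1) ∧
      ∀ l₁ p l₂, l = l₁ ++ p :: l₂ → γ ≤ A.roundLoss l₁ p := by
  obtain ⟨τ, hτ, hγ⟩ := hS
  -- Path and stream are built together: the prediction at the current node is the index of the next
  -- edge, whose set is then revealed.
  have key : ∀ n : ℕ, ∃ (q : List (ProbabilityMeasure Y)) (l : List (X × 𝒮)), q.length = n ∧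
      l.length = n ∧ ∀ t < n,
        l[t]? = some (τ.node (q.take t), τ.edge (q.take (t + 1))) ∧
        q[t]? = some (A (l.take t) (τ.node (q.take t))) := by
    intro n
    induction n with
    | zero => exact ⟨[], [], rfl, rfl, by simp⟩
    | succ n ih =>
      obtain ⟨q, l, hq, hl, hql⟩ := ih
      set μ := A l (τ.node q)
      refine ⟨q ++ [μ], l ++ [(τ.node q, τ.edge (q ++ [μ]))], by simp [hq], by simp [hl],
        fun t ht => ?_⟩
      rcases Nat.lt_succ_iff_lt_or_eq.1 ht with h | rfl
      · rw [List.take_append_of_le_length (by omega), List.take_append_of_le_length (by omega),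
          List.take_append_of_le_length (by omega), List.getElem?_append_left (by omega),
          List.getElem?_append_left (by omega)]
        exact hql t h
      · rw [List.take_of_length_le (l := q ++ [μ]) (i := t + 1) (by simp [hq])]
        constructor
        · rw [← hq, List.take_left, hq, ← hl, List.getElem?_concat_length]
        · rw [← hl, List.take_left, hl, ← hq, List.take_left, List.getElem?_concat_length]
  obtain ⟨q, l, hq, hl, hql⟩ := key d
  refine ⟨l, hl, ?_, ?_⟩
  · obtain ⟨h, hh, hr⟩ := hτ q hq
    refine ⟨h, hh, fun p hp => ?_⟩
    obtain ⟨t, ht, rfl⟩ := List.getElem_of_mem hp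
    have h1 := (hql t (hl ▸ ht)).1
    rw [List.getElem?_eq_getElem ht, Option.some_inj] at h1
    rw [h1]
    exact hr t (hl ▸ ht)
  · rintro l₁ p l₂ rfl
    have ht : l₁.length < d := by rw [← hl]; simp
    obtain ⟨h1, h2⟩ := hql _ ht
    rw [List.getElem?_append_right le_rfl] at h1
    simp only [Nat.sub_self, List.getElem?_cons_zero, Option.some_inj] at h1
    rw [List.take_left, List.getElem?_eq_getElem (by omega), Option.some_inj] at h2
    have h3 := hγ q hq _ (by omega : l₁.length < q.length)
    rw [h2] at h3
    rw [Learner.roundLoss, h1]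
    dsimp only
    linarith

theorem Learner.le_cumLoss_of_roundLoss (A : Learner X 𝒮) {γ : ℝ} {l : List (X × 𝒮)}
    (h : ∀ l₁ p l₂, l = l₁ ++ p :: l₂ → γ ≤ A.roundLoss l₁ p) :
    γ * l.length ≤ A.cumLoss [] l := by
  induction l using List.reverseRecOn with
  | nil => simp [Learner.cumLoss]
  | append_singleton l p ih =>
    have h1 := ih fun l₁ q l₂ hl => h l₁ q (l₂ ++ [p]) (by simp [hl])
    have h2 := h l p [] rfl
    rw [A.cumLoss_concat]
    push_cast [List.length_append, List.length_singleton]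
    linarith

theorem MSShatters.mul_le_regret (h𝒮 : ∀ S ∈ 𝒮, MeasurableSet S) {γ : ℝ} {H : Set (X → Y)} {d : ℕ}
    (hS : MSShatters 𝒮 γ H d) (A : Learner X 𝒮) : ((γ * d : ℝ) : EReal) ≤ A.regret H d := by
  obtain ⟨l, hl, ⟨h, hh, hr⟩, hγ⟩ := hS.exists_stream A
  have h1 := A.le_cumLoss_of_roundLoss hγ
  rw [← hl]
  refine A.le_regret_of_hypLoss h𝒮 hh ?_
  rw [hypLoss_eq_zero hr]
  linarith

theorem MSShatters.exists_realizable {γ : ℝ} {H : Set (X → Y)} {d : ℕ}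
    (hS : MSShatters 𝒮 γ H d) (hd : d ≠ 0) [Nonempty Y] :
    ∃ h ∈ H, ∃ p : X × 𝒮, h p.1 ∈ p.2.1 := by
  obtain ⟨l, hl, ⟨h, hh, hr⟩, -⟩ := hS.exists_stream (fun _ _ => Classical.arbitrary _)
  cases l with
  | nil => exact absurd hl.symm hd
  | cons p l => exact ⟨h, hh, p, hr p (by simp)⟩

/-- Against labels from two disjoint sets revealed on the same instance, the adversary forces the
excess loss that a fair coin would force. -/
theorem Learner.exists_block (h𝒮 : ∀ S ∈ 𝒮, MeasurableSet S) (A : Learner X 𝒮) (x : X)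
    (S₀ S₁ : 𝒮) (hS : Disjoint S₀.1 S₁.1) (n : ℕ) (pre : List (X × 𝒮)) (z : ℤ) :
    ∃ (l : List (X × 𝒮)) (w : ℤ), l.length = n ∧
      walkAbs n z / 2 ≤ A.cumLoss pre l - n / 2 + |(w : ℝ)| / 2 ∧ ∀ h : X → Y,
        (h x ∈ S₀.1 → hypLoss h l ≤ (n - (w - z)) / 2) ∧
        (h x ∈ S₁.1 → hypLoss h l ≤ (n + (w - z)) / 2) := by
  induction n generalizing pre z with
  | zero => exact ⟨[], z, rfl, by simp [walkAbs, cumLoss], by simp [hypLoss]⟩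
  | succ n ih =>
    obtain ⟨l₀, w₀, hl₀, hV₀, hh₀⟩ := ih (pre ++ [(x, S₀)]) (z + 1)
    obtain ⟨l₁, w₁, hl₁, hV₁, hh₁⟩ := ih (pre ++ [(x, S₁)]) (z - 1)
    -- No measure can give two disjoint sets total mass above one, so a fair coin would cost at
    -- least one half; one of the two choices does at least as well as their average.
    have hsum : 1 ≤ A.roundLoss pre (x, S₀) + A.roundLoss pre (x, S₁) := by
      have h1 : (A pre x : Measure Y).real (S₀.1 ∪ S₁.1) ≤ 1 := measureReal_le_one
      rw [measureReal_union hS (h𝒮 _ S₁.2)] at h1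
      simp only [roundLoss]
      linarith
    have hw : walkAbs (n + 1) z = (walkAbs n (z + 1) + walkAbs n (z - 1)) / 2 := rfl
    rcases le_total (walkAbs (n + 1) z / 2)
      (A.roundLoss pre (x, S₀) - 1 / 2 + walkAbs n (z + 1) / 2) with hc | hc
    · refine ⟨(x, S₀) :: l₀, w₀, by simp [hl₀], ?_, fun h => ⟨fun hx => ?_, fun hx => ?_⟩⟩
      · rw [cumLoss]; push_cast; linarith
      · have := (hh₀ h).1 hx
        rw [hypLoss_cons, setLoss_of_mem hx]; push_cast at this ⊢; linarith
      · have := (hh₀ h).2 hx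
        have h1 := setLoss_le_one S₀.1 (h x)
        rw [hypLoss_cons]; push_cast at this ⊢; linarith
    · refine ⟨(x, S₁) :: l₁, w₁, by simp [hl₁], ?_, fun h => ⟨fun hx => ?_, fun hx => ?_⟩⟩
      · rw [cumLoss]; push_cast; linarith
      · have := (hh₁ h).1 hx
        have h1 := setLoss_le_one S₁.1 (h x)
        rw [hypLoss_cons]; push_cast at this ⊢; linarith
      · have := (hh₁ h).2 hx
        rw [hypLoss_cons, setLoss_of_mem hx]; push_cast at this ⊢; linarith

/-- Blocks of prescribed lengths along a path of a shattered binary tree. -/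
theorem SLShatters.sum_walkAbs_le_regret (h𝒮 : ∀ S ∈ 𝒮, MeasurableSet S) {H : Set (X → Y)} {d : ℕ}
    (hS : SLShatters 𝒮 2 H d) (A : Learner X 𝒮) (k : ℕ → ℕ) :
    (((∑ j ∈ Finset.range d, walkAbs (k j) 0) / 2 : ℝ) : EReal) ≤
      A.regret H (∑ j ∈ Finset.range d, k j) := by
  obtain ⟨τ, hτ, hdisj⟩ := hS
  have key : ∀ i ≤ d, ∃ (q : List (Fin 2)) (l : List (X × 𝒮)), q.length = i ∧
      l.length = ∑ j ∈ Finset.range i, k j ∧ ∀ h : X → Y,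
        (∀ t < i, h (τ.node (q.take t)) ∈ (τ.edge (q.take (t + 1))).1) →
        (∑ j ∈ Finset.range i, walkAbs (k j) 0) / 2 ≤ A.cumLoss [] l - hypLoss h l := by
    intro i
    induction i with
    | zero => exact fun _ => ⟨[], [], rfl, rfl, fun h _ => by simp [Learner.cumLoss, hypLoss]⟩
    | succ i ih =>
      intro hi
      obtain ⟨q, l, hq, hl, hql⟩ := ih (by omega)
      have hd : Disjoint (τ.edge (q ++ [0])).1 (τ.edge (q ++ [1])).1 := by
        have := hdisj (q ++ List.replicate (d - i) 0) (by simp; omega) i (by omega)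
        rw [← hq, List.take_left] at this
        rw [Set.disjoint_iff_inter_eq_empty, ← this]
        ext y
        simp [Fin.forall_fin_two]
      obtain ⟨l', w, hl', hV, hh⟩ := A.exists_block h𝒮 (τ.node q) _ _ hd (k i) l 0
      -- The sign of the final position `w` tells which set was revealed more often, hence which
      -- edge to descend.
      have hb : ∃ b : Fin 2, ∀ h : X → Y, h (τ.node q) ∈ (τ.edge (q ++ [b])).1 →
          hypLoss h l' ≤ (k i - |(w : ℝ)|) / 2 := by
        rcases le_total 0 (w : ℝ) with hw | hw
        · refine ⟨0, fun h hx => ?_⟩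
          have := (hh h).1 hx
          rw [abs_of_nonneg hw]; push_cast at this; linarith
        · refine ⟨1, fun h hx => ?_⟩
          have := (hh h).2 hx
          rw [abs_of_nonpos hw]; push_cast at this; linarith
      obtain ⟨b, hb⟩ := hb
      refine ⟨q ++ [b], l ++ l', by simp [hq], by simp [hl, hl', Finset.sum_range_succ],
        fun h hr => ?_⟩
      have h1 := hql h fun t ht => by
        have := hr t (by omega)
        rwa [List.take_append_of_le_length (by omega), List.take_append_of_le_length (by omega)]
          at this
      have h2 := hb h (by
        have := hr i (by omega)
        rwa [List.take_of_length_le (l := q ++ [b]) (by simp [hq]), ← hq, List.take_left] at this)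
      rw [Finset.sum_range_succ, A.cumLoss_append, hypLoss_append, List.nil_append]
      linarith
  obtain ⟨q, l, hq, hl, hql⟩ := key d le_rfl
  obtain ⟨h, hh, hr⟩ := hτ q hq
  rw [← hl]
  exact A.le_regret_of_hypLoss h𝒮 hh (hql h hr)

/-- Block lengths differing by at most one fill the horizon exactly. Half of the walk bound `√(d T /
2)` is `√(d T / 8)`. -/
theorem SLShatters.sqrt_le_regret (h𝒮 : ∀ S ∈ 𝒮, MeasurableSet S) {H : Set (X → Y)} {d T : ℕ}
    (hS : SLShatters 𝒮 2 H d) (A : Learner X 𝒮) (hd : d ≠ 0) (hdT : d ≤ T) :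
    ((√((d : ℝ) * T / 8) : ℝ) : EReal) ≤ A.regret H T := by
  have hk : 1 ≤ T / d := (Nat.one_le_div_iff (Nat.pos_of_ne_zero hd)).2 hdT
  have hr : T % d ≤ d := (Nat.mod_lt _ (Nat.pos_of_ne_zero hd)).le
  have h1 := hS.sum_walkAbs_le_regret h𝒮 A fun j => if j < T % d then T / d + 1 else T / d
  have hf : ∀ f : ℕ → ℝ, ∑ j ∈ Finset.range d, f (if j < T % d then T / d + 1 else T / d) =
      (d - (T % d : ℕ)) * f (T / d) + (T % d : ℕ) * f (T / d + 1) := by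
    intro f
    rw [← Finset.sum_range_add_sum_Ico _ hr,
      Finset.sum_congr rfl (g := fun _ => f (T / d + 1))
        fun j hj => by rw [if_pos (Finset.mem_range.1 hj)],
      Finset.sum_congr (s₁ := Finset.Ico _ _) rfl (g := fun _ => f (T / d))
        fun j hj => by rw [if_neg (not_lt.2 (Finset.mem_Ico.1 hj).1)]]
    simp [Nat.cast_sub hr, add_comm]
  have hT : ((T / d : ℕ) : ℝ) * d + (T % d : ℕ) = T := by exact_mod_cast Nat.div_add_mod' T d
  have hsum : ∑ j ∈ Finset.range d, (if j < T % d then T / d + 1 else T / d) = T := by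
    have := hf fun n => n
    rw [← Nat.cast_sum] at this
    have h3 : ((d : ℝ) - (T % d : ℕ)) * (T / d : ℕ) + (T % d : ℕ) * ((T / d + 1 : ℕ) : ℝ) = T := by
      push_cast at hT ⊢; linarith
    exact_mod_cast this.trans h3
  rw [hsum, hf fun n => walkAbs n 0] at h1
  refine le_trans (EReal.coe_le_coe_iff.2 ?_) h1
  have h2 := sqrt_le_walkAbs_balanced hk hr
  rw [show (d : ℝ) * T / 8 = (d * (d * (T / d : ℕ) + (T % d : ℕ)) / 2) / 2 ^ 2 by
    rw [mul_comm (d : ℝ) ((T / d : ℕ) : ℝ), hT]; ring, Real.sqrt_div' _ (by norm_num),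
    Real.sqrt_sq (by norm_num)]
  linarith

end Truncation

/-! ### Exponential weights -/

section Hedge

/-- Hoeffding's lemma for a finite mixture of numbers in the unit interval. -/
theorem sum_mul_exp_neg_le {ι : Type*} [Fintype ι] {w a : ι → ℝ} (hw : ∀ i, 0 ≤ w i)
    (hw1 : ∑ i, w i = 1) (ha : ∀ i, a i ∈ Icc (0 : ℝ) 1) (η : ℝ) :
    ∑ i, w i * Real.exp (-η * a i) ≤ Real.exp (-η * (∑ i, w i * a i) + η ^ 2 / 8) := by
  let _ : MeasurableSpace ι := ⊤
  let p : PMF ι := PMF.ofFintype (fun i => ENNReal.ofReal (w i)) (by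
    rw [← ENNReal.ofReal_sum_of_nonneg fun i _ => hw i, hw1, ENNReal.ofReal_one])
  have hint : ∀ f : ι → ℝ, ∫ i, f i ∂p.toMeasure = ∑ i, w i * f i := by
    intro f
    rw [PMF.integral_eq_sum]
    simp [p, ENNReal.toReal_ofReal, hw]
  have h := (ProbabilityTheory.hasSubgaussianMGF_of_mem_Icc (μ := p.toMeasure) (X := a) (a := 0)
    (b := 1) (measurable_of_finite a).aemeasurable (Eventually.of_forall ha)).mgf_le (-η)
  rw [hint a, ProbabilityTheory.mgf, hint] at h
  set m := ∑ i, w i * a i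
  have e1 : ∀ i, w i * Real.exp (-η * (a i - m)) =
      Real.exp (η * m) * (w i * Real.exp (-η * a i)) := by
    intro i
    rw [show -η * (a i - m) = η * m + -η * a i by ring, Real.exp_add]
    ring
  rw [Finset.sum_congr rfl fun i _ => e1 i, ← Finset.mul_sum] at h
  have e2 : ((((‖(1 : ℝ) - 0‖₊ / 2) ^ 2 : NNReal) : ℝ) * (-η) ^ 2 / 2) = η ^ 2 / 8 := by
    simp
    ring
  rw [e2] at h
  rw [Real.exp_add, show -η * m = -(η * m) by ring, Real.exp_neg, inv_mul_eq_div,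
    le_div_iff₀ (Real.exp_pos _), mul_comm]
  exact h

variable {X : Type u} {Y : Type v} [MeasurableSpace Y] {𝒮 : Set (Set Y)}

theorem exists_mixture {ι : Type*} [Fintype ι] {w : ι → ℝ} (hw : ∀ i, 0 ≤ w i)
    (hw1 : ∑ i, w i = 1) (μ : ι → ProbabilityMeasure Y) :
    ∃ ν : ProbabilityMeasure Y, ∀ S : Set Y,
      (ν : Measure Y).real S = ∑ i, w i * (μ i : Measure Y).real S := by
  have happ : ∀ S : Set Y, (∑ i, ENNReal.ofReal (w i) • (μ i : Measure Y)) S =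
      ∑ i, ENNReal.ofReal (w i) * (μ i : Measure Y) S := by
    intro S
    simp [Measure.finsetSum_apply]
  refine ⟨⟨∑ i, ENNReal.ofReal (w i) • (μ i : Measure Y), ⟨?_⟩⟩, fun S => ?_⟩
  · rw [happ]
    simp only [measure_univ, mul_one]
    rw [← ENNReal.ofReal_sum_of_nonneg fun i _ => hw i, hw1, ENNReal.ofReal_one]
  · simp only [ProbabilityMeasure.coe_mk, measureReal_def]
    rw [happ, ENNReal.toReal_sum fun i _ => ENNReal.mul_ne_top ENNReal.ofReal_ne_top
      (measure_ne_top _ _)]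
    simp [ENNReal.toReal_mul, ENNReal.toReal_ofReal, hw]

variable {ι : Type*} [Fintype ι] [Nonempty ι]

/-- The exponentially weighted average of finitely many learners, with learning rate `η`. -/
theorem exists_exponentialWeights (E : ι → Learner X 𝒮) (η : ℝ) :
    ∃ A : Learner X 𝒮, ∀ (l : List (X × 𝒮)) (i : ι),
      η * A.cumLoss [] l ≤
        η * (E i).cumLoss [] l + Real.log (Fintype.card ι) + η ^ 2 / 8 * l.length := by
  let c : List (X × 𝒮) → ι → ℝ := fun l i => Real.exp (-η * (E i).cumLoss [] l)
  let W : List (X × 𝒮) → ℝ := fun l => ∑ i, c l i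
  have hc : ∀ l i, 0 < c l i := fun l i => Real.exp_pos _
  have hW : ∀ l, 0 < W l := fun l => Finset.sum_pos (fun i _ => hc l i) Finset.univ_nonempty
  have hw1 : ∀ l, ∑ i, c l i / W l = 1 := fun l => by
    rw [← Finset.sum_div, div_self (hW l).ne']
  have hw0 : ∀ l i, 0 ≤ c l i / W l := fun l i => (div_pos (hc l i) (hW l)).le
  choose B hB using fun (l : List (X × 𝒮)) (x : X) =>
    exists_mixture (hw0 l) (hw1 l) fun i => E i l x
  obtain ⟨A, hA⟩ : ∃ A : Learner X 𝒮, ∀ l x S, (A l x : Measure Y).real S =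
      ∑ i, c l i / W l * (E i l x : Measure Y).real S := ⟨B, hB⟩
  refine ⟨A, fun l i => ?_⟩
  have hround : ∀ l p, A.roundLoss l p = ∑ i, c l i / W l * (E i).roundLoss l p := by
    intro l p
    simp only [Learner.roundLoss, hA, mul_sub, mul_one, Finset.sum_sub_distrib, hw1]
  -- The total weight is the potential: Hoeffding's lemma bounds its factor in each round by `exp
  -- (-η · loss + η² / 8)`.
  have key : W l ≤ Fintype.card ι *
      Real.exp (-η * A.cumLoss [] l + η ^ 2 / 8 * l.length) := by
    induction l using List.reverseRecOn with
    | nil => simp [W, c, Learner.cumLoss]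
    | append_singleton l p ih =>
      have h1 : W (l ++ [p]) = W l * ∑ i, c l i / W l * Real.exp (-η * (E i).roundLoss l p) := by
        rw [Finset.mul_sum]
        refine Finset.sum_congr rfl fun i _ => ?_
        simp only [c]
        rw [Learner.cumLoss_concat, mul_add, Real.exp_add]
        have := (hW l).ne'
        field_simp
      have h2 := sum_mul_exp_neg_le (hw0 l) (hw1 l)
        (fun i => ⟨(E i).roundLoss_nonneg l p, (E i).roundLoss_le_one l p⟩) η
      rw [← hround] at h2
      rw [h1]
      refine (mul_le_mul ih h2 (Finset.sum_nonneg fun i _ =>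
        mul_nonneg (hw0 l i) (Real.exp_pos _).le) (by positivity)).trans_eq ?_
      rw [mul_assoc, ← Real.exp_add, Learner.cumLoss_concat]
      congr 2
      push_cast [List.length_append, List.length_singleton]
      ring
  have h3 : c l i ≤ W l := Finset.single_le_sum (f := c l) (fun i _ => (hc l i).le)
    (Finset.mem_univ i)
  have h4 := Real.log_le_log (hc l i) (h3.trans key)
  rw [Real.log_mul (by exact_mod_cast Fintype.card_ne_zero) (Real.exp_pos _).ne',
    Real.log_exp, Real.log_exp] at h4
  linarith

theorem exists_hedge (E : ι → Learner X 𝒮) (T : ℕ) :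
    ∃ A : Learner X 𝒮, ∀ (l : List (X × 𝒮)) (i : ι), l.length = T →
      A.cumLoss [] l ≤ (E i).cumLoss [] l + √(T * Real.log (Fintype.card ι) / 2) := by
  have hcard : 1 ≤ Fintype.card ι := Fintype.card_pos
  rcases hcard.eq_or_lt with h1 | h1
  · obtain ⟨i₀⟩ := ‹Nonempty ι›
    have : Subsingleton ι := Fintype.card_le_one_iff_subsingleton.1 h1.ge
    refine ⟨E i₀, fun l i _ => ?_⟩
    rw [Subsingleton.elim i i₀]
    exact le_add_of_nonneg_right (Real.sqrt_nonneg _)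
  have hN : 0 < Real.log (Fintype.card ι) := Real.log_pos (by exact_mod_cast h1)
  set N := Real.log (Fintype.card ι)
  rcases Nat.eq_zero_or_pos T with rfl | hT
  · refine ⟨E (Classical.arbitrary ι), fun l i hl => ?_⟩
    rw [List.eq_nil_of_length_eq_zero hl]
    simp [Learner.cumLoss]
  have hT' : (0 : ℝ) < T := by exact_mod_cast hT
  set r := √(T * N / 2)
  have hr : r ^ 2 = T * N / 2 := Real.sq_sqrt (by positivity)
  have hr0 : 0 < r := Real.sqrt_pos.2 (by positivity)
  -- This is the optimal rate `√(8 N / T)`; both error terms then equal `r / 2` after division by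
  -- it.
  obtain ⟨A, hA⟩ := exists_exponentialWeights E (4 * r / T)
  refine ⟨A, fun l i hl => ?_⟩
  have h := hA l i
  rw [hl] at h
  have e : (4 * r / T) ^ 2 / 8 * T = 4 * r / T * (r / 2) := by field_simp; ring
  have e2 : N = 4 * r / T * (r / 2) := by field_simp; linarith
  have h' : 4 * r / T * A.cumLoss [] l ≤ 4 * r / T * ((E i).cumLoss [] l + r) := by
    calc _ ≤ _ := h
      _ = _ := by rw [e]; linear_combination e2
  exact le_of_mul_le_mul_left h' (by positivity)

end Hedge

/-! ### The measure-valued standard optimal algorithm and the upper bound -/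

section MeasureSOA

variable {X : Type u} {Y : Type v} {𝒮 : Set (Set Y)}

/-- The hypotheses in `V` that are correct on the example `p`. -/
def restrict (V : Set (X → Y)) (p : X × 𝒮) : Set (X → Y) :=
  {h ∈ V | h p.1 ∈ p.2.1}

/-- The version space and the remaining budget after the updates at the rounds in `L`. -/
def versionState (H : Set (X → Y)) (k : ℕ) (L : Set ℕ) (l : List (X × 𝒮)) :
    Set (X → Y) × ℕ :=
  open Classical in
  l.zipIdx.foldl (fun s p => if p.2 ∈ L then (restrict s.1 p.1, s.2 - 1) else s) (H, k)

theorem versionState_concat (H : Set (X → Y)) (k : ℕ) (L : Set ℕ) (l : List (X × 𝒮))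
    (p : X × 𝒮) : versionState H k L (l ++ [p]) =
      open Classical in
      if l.length ∈ L then (restrict (versionState H k L l).1 p, (versionState H k L l).2 - 1)
      else versionState H k L l := by
  simp [versionState, List.zipIdx_append, List.foldl_append]

theorem versionState_congr (H : Set (X → Y)) (k : ℕ) {L L' : Set ℕ} {l : List (X × 𝒮)}
    (h : ∀ t < l.length, t ∈ L ↔ t ∈ L') : versionState H k L l = versionState H k L' l := by
  induction l using List.reverseRecOn with
  | nil => rfl
  | append_singleton l p ih =>
    rw [versionState_concat, versionState_concat, ih fun t ht => h t (by simp; omega)]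
    have hl := h l.length (by simp)
    by_cases hL : l.length ∈ L
    · rw [if_pos hL, if_pos (hl.1 hL)]
    · rw [if_neg hL, if_neg fun hc => hL (hl.2 hc)]

variable [MeasurableSpace Y]

theorem msShatters_zero_iff [Nonempty X] [Nonempty 𝒮] {γ : ℝ} {V : Set (X → Y)} :
    MSShatters 𝒮 γ V 0 ↔ V.Nonempty := by
  constructor
  · rintro ⟨τ, hτ, -⟩
    obtain ⟨h, hh, -⟩ := hτ [] rfl
    exact ⟨h, hh⟩
  · rintro ⟨h, hh⟩
    refine ⟨⟨fun _ => Classical.arbitrary X, fun _ => Classical.arbitrary 𝒮⟩,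
      fun q _ => ⟨h, hh, by simp⟩, fun q hq t ht => ?_⟩
    omega

/-- Attaching shattered trees below the edges of a new root. -/
theorem MSShatters.succ [Nonempty Y] {γ : ℝ} {V : Set (X → Y)} {k : ℕ} (x : X)
    (h : ∀ μ : ProbabilityMeasure Y, ∃ S : 𝒮, (μ : Measure Y).real S.1 ≤ 1 - γ ∧
      MSShatters 𝒮 γ (restrict V (x, S)) k) : MSShatters 𝒮 γ V (k + 1) := by
  choose S hS τ hτ hτγ using h
  refine ⟨⟨fun q => match q with
      | [] => x
      | μ :: q => (τ μ).node q, fun q => match q with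
      -- The empty word addresses no edge, so this value is never inspected.
      | [] => S (Classical.arbitrary _)
      | [μ] => S μ
      | μ :: ν :: q => (τ μ).edge (ν :: q)⟩, ?_, ?_⟩
  · rintro (_ | ⟨μ, q⟩) hq
    · simp at hq
    · obtain ⟨g, hg, hgq⟩ := hτ μ q (by simpa using hq)
      refine ⟨g, hg.1, fun t ht => ?_⟩
      cases t with
      | zero => simpa using hg.2
      | succ t =>
        have hr := hgq t (by omega)
        cases q with
        | nil => simp at hq; omega
        | cons ν q => simpa using hr
  · rintro (_ | ⟨μ, q⟩) hq t ht
    · simp at hq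
    · cases t with
      | zero => simpa using hS μ
      | succ t =>
        have hr := hτγ μ q (by simpa using hq) t (by simpa using ht)
        cases q with
        | nil => simp at ht
        | cons ν q => simpa using hr

open Classical in
/-- A prediction after which every set of small measure lowers the dimension of the version space
below the remaining budget. -/
def soaPrediction [Nonempty Y] (𝒮 : Set (Set Y)) (γ : ℝ) (s : Set (X → Y) × ℕ) (x : X) :
    ProbabilityMeasure Y :=
  if h : ∃ μ : ProbabilityMeasure Y, ∀ S : 𝒮, (μ : Measure Y).real S.1 ≤ 1 - γ →
      ¬ MSShatters 𝒮 γ (restrict s.1 (x, S)) (s.2 - 1) then h.choose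
  else Classical.arbitrary _

/-- If every measure admitted a set of small mass whose restriction is still shattered at depth `k`,
these trees could be hung below the root `p.1`; hence the good measure sought by `soaPrediction`
exists. -/
theorem not_msShatters_restrict [Nonempty Y] {γ : ℝ} {V : Set (X → Y)} {k : ℕ}
    (hV : ¬ MSShatters 𝒮 γ V (k + 1)) (p : X × 𝒮)
    (hp : (soaPrediction 𝒮 γ (V, k + 1) p.1 : Measure Y).real p.2.1 ≤ 1 - γ) :
    ¬ MSShatters 𝒮 γ (restrict V p) k := by
  have h : ∃ μ : ProbabilityMeasure Y, ∀ S : 𝒮, (μ : Measure Y).real S.1 ≤ 1 - γ →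
      ¬ MSShatters 𝒮 γ (restrict V (p.1, S)) k := by
    by_contra! hcon
    exact hV (MSShatters.succ p.1 hcon)
  rw [soaPrediction] at hp
  split_ifs at hp with h'
  · exact h'.choose_spec p.2 hp
  · exact absurd h h'

/-- The learner that plays `soaPrediction` and updates its version space at the rounds in `L`. -/
def soaLearner [Nonempty Y] (𝒮 : Set (Set Y)) (γ : ℝ) (H : Set (X → Y)) (k : ℕ) (L : Set ℕ) :
    Learner X 𝒮 :=
  fun l x => soaPrediction 𝒮 γ (versionState H k L l) x

theorem soaLearner_cumLoss_congr [Nonempty Y] (γ : ℝ) (H : Set (X → Y)) (k : ℕ) {L L' : Set ℕ}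
    {l : List (X × 𝒮)} (h : ∀ t < l.length, t ∈ L ↔ t ∈ L') :
    (soaLearner 𝒮 γ H k L).cumLoss [] l = (soaLearner 𝒮 γ H k L').cumLoss [] l := by
  refine Learner.cumLoss_congr fun l₁ p l₂ hl => ?_
  simp only [soaLearner, List.nil_append]
  rw [versionState_congr H k fun t ht => h t (by rw [hl]; simp; omega)]

/-- Relative to any hypothesis, a suitable choice of at most `d` update rounds is competitive. -/
theorem exists_updateRounds [Nonempty X] [Nonempty Y] [Nonempty 𝒮] {γ : ℝ} (hγ : 0 ≤ γ)
    {H : Set (X → Y)} {d : ℕ} (hd : ¬ MSShatters 𝒮 γ H (d + 1)) {h : X → Y} (hh : h ∈ H)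
    (l : List (X × 𝒮)) :
    ∃ L : Finset ℕ, (∀ t ∈ L, t < l.length) ∧ L.card ≤ d ∧
      (soaLearner 𝒮 γ H (d + 1) L).cumLoss [] l ≤ hypLoss h l + (L.card + γ * l.length) := by
  -- Invariant: budget plus updates is `d + 1`, `h` survives, and the version space is not shattered
  -- at the budget. The budget cannot reach zero, since a non-empty class is shattered at depth
  -- zero.
  suffices key : ∃ L : Finset ℕ, (∀ t ∈ L, t < l.length) ∧
      (versionState H (d + 1) L l).2 + L.card = d + 1 ∧
      h ∈ (versionState H (d + 1) L l).1 ∧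
      ¬ MSShatters 𝒮 γ (versionState H (d + 1) L l).1 (versionState H (d + 1) L l).2 ∧
      (soaLearner 𝒮 γ H (d + 1) L).cumLoss [] l ≤ hypLoss h l + (L.card + γ * l.length) by
    obtain ⟨L, hL, hcard, hmem, hns, hloss⟩ := key
    refine ⟨L, hL, ?_, hloss⟩
    by_contra! hlt
    have h0 : (versionState H (d + 1) L l).2 = 0 := by omega
    rw [h0, msShatters_zero_iff] at hns
    exact hns ⟨h, hmem⟩
  induction l using List.reverseRecOn with
  | nil => exact ⟨∅, by simp, by simp [versionState], hh, hd, by simp [Learner.cumLoss, hypLoss]⟩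
  | append_singleton l p ih =>
    obtain ⟨L, hL, hcard, hmem, hns, hloss⟩ := ih
    have hnot : l.length ∉ L := fun hc => (hL _ hc).false
    set s := versionState H (d + 1) L l with hs
    obtain ⟨k, hk⟩ : ∃ k, s.2 = k + 1 := by
      refine Nat.exists_eq_succ_of_ne_zero fun h0 => ?_
      rw [h0, msShatters_zero_iff] at hns
      exact hns ⟨h, hmem⟩
    have hround : (soaLearner 𝒮 γ H (d + 1) L).roundLoss l p =
        1 - (soaPrediction 𝒮 γ s p.1 : Measure Y).real p.2.1 := rfl
    -- An update round is charged at most one, to the cardinality of `L`. In any other round either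
    -- `h` errs as well or the learner loses less than `γ`.
    by_cases hup : h p.1 ∈ p.2.1 ∧ (soaPrediction 𝒮 γ s p.1 : Measure Y).real p.2.1 ≤ 1 - γ
    · have hag : ∀ t < l.length, t ∈ ((insert l.length L : Finset ℕ) : Set ℕ) ↔ t ∈ (L : Set ℕ) :=
        fun t ht => by simp [ht.ne]
      have hst : versionState H (d + 1) ((insert l.length L : Finset ℕ) : Set ℕ) (l ++ [p]) =
          (restrict s.1 p, k) := by
        rw [versionState_concat, if_pos (by simp), versionState_congr H (d + 1) hag, ← hs, hk]
        rfl
      refine ⟨insert l.length L, ?_, ?_, ?_, ?_, ?_⟩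
      · intro t ht
        rcases Finset.mem_insert.1 ht with rfl | ht
        · simp
        · have := hL t ht; simp; omega
      · rw [hst, Finset.card_insert_of_notMem hnot]; dsimp only; omega
      · rw [hst]; exact ⟨hmem, hup.1⟩
      · rw [hst]
        refine not_msShatters_restrict (by rwa [hk] at hns) p ?_
        rw [← hk]; exact hup.2
      · rw [Learner.cumLoss_concat, soaLearner_cumLoss_congr γ H (d + 1) hag, hypLoss_append,
          hypLoss_singleton, Finset.card_insert_of_notMem hnot]
        have h1 := (soaLearner 𝒮 γ H (d + 1) ((insert l.length L : Finset ℕ) : Set ℕ)).roundLoss_le_one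
          l p
        have h2 := setLoss_nonneg p.2.1 (h p.1)
        push_cast [List.length_append, List.length_singleton] at h1 ⊢
        linarith
    · have hst : versionState H (d + 1) L (l ++ [p]) = s := by
        rw [versionState_concat, if_neg (by simpa using hnot)]
      refine ⟨L, fun t ht => by have := hL t ht; simp; omega, ?_, ?_, ?_, ?_⟩
      · rw [hst]; exact hcard
      · rw [hst]; exact hmem
      · rw [hst]; exact hns
      · have hr : (soaLearner 𝒮 γ H (d + 1) L).roundLoss l p ≤ setLoss p.2.1 (h p.1) + γ := by
          by_cases hp : h p.1 ∈ p.2.1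
          · have : ¬ _ := fun hc => hup ⟨hp, hc⟩
            rw [setLoss_of_mem hp, hround]
            linarith
          · rw [setLoss_of_notMem hp]
            have := (soaLearner 𝒮 γ H (d + 1) L).roundLoss_le_one l p
            linarith
        rw [Learner.cumLoss_concat, hypLoss_append, hypLoss_singleton]
        push_cast [List.length_append, List.length_singleton]
        linarith

/-- Any at most `d` rounds before the horizon are listed by some function on `Fin d`. -/
theorem exists_enumeration {T d : ℕ} {L : Finset ℕ} (hL : ∀ t ∈ L, t < T) (hd : L.card ≤ d) :
    ∃ f : Fin d → Fin (T + 1), ∀ t < T, (t ∈ L ↔ ∃ i, (f i : ℕ) = t) := by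
  -- Spare indices are sent to `T`, a round that never occurs.
  refine ⟨fun i => if h : i.1 < L.card then
    ⟨(L.equivFin.symm ⟨i.1, h⟩).1, (hL _ (L.equivFin.symm ⟨i.1, h⟩).2).trans T.lt_succ_self⟩
    else Fin.last T, fun t ht => ⟨fun htL => ?_, ?_⟩⟩
  · refine ⟨⟨(L.equivFin ⟨t, htL⟩).1, (L.equivFin ⟨t, htL⟩).2.trans_le hd⟩, ?_⟩
    simp
  · rintro ⟨i, rfl⟩
    by_cases h : i.1 < L.card
    · simp only [dif_pos h]
      exact (L.equivFin.symm ⟨i.1, h⟩).2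
    · simp [dif_neg h] at ht

/-- Hedge runs over the `(T + 1) ^ d` functions that list the update rounds, one of which suits the
comparator at hand. -/
theorem exists_agnostic_learner [Nonempty X] [Nonempty Y] [Nonempty 𝒮] {γ : ℝ} (hγ : 0 ≤ γ)
    {H : Set (X → Y)} {d : ℕ} (hd : ¬ MSShatters 𝒮 γ H (d + 1)) (T : ℕ) :
    ∃ A : Learner X 𝒮, ∀ l : List (X × 𝒮), l.length = T → ∀ h ∈ H,
      A.cumLoss [] l ≤ hypLoss h l +
        (d + γ * T + √(T * (d * Real.log (T + 1)) / 2)) := by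
  obtain ⟨A, hA⟩ := exists_hedge (fun f : Fin d → Fin (T + 1) =>
    soaLearner 𝒮 γ H (d + 1) {t | ∃ i, (f i : ℕ) = t}) T
  refine ⟨A, fun l hl h hh => ?_⟩
  obtain ⟨L, hL, hcard, hloss⟩ := exists_updateRounds hγ hd hh l
  obtain ⟨f, hf⟩ := exists_enumeration (hl ▸ hL) hcard
  have h1 := hA l f hl
  rw [← soaLearner_cumLoss_congr (L := (L : Set ℕ)) γ H (d + 1) fun t ht => by
    simpa using hf t (hl ▸ ht)] at h1
  have h2 : Real.log (Fintype.card (Fin d → Fin (T + 1))) = d * Real.log (T + 1) := by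
    simp [Real.log_pow]
  rw [h2] at h1
  rw [hl] at hloss
  have h3 : (L.card : ℝ) ≤ d := by exact_mod_cast hcard
  linarith

theorem exists_regret_le (h𝒮 : ∀ S ∈ 𝒮, MeasurableSet S) [Nonempty X] [Nonempty 𝒮] {γ : ℝ}
    (hγ : 0 ≤ γ) {H : Set (X → Y)} (hH : H.Nonempty) {d : ℕ} (hd : ¬ MSShatters 𝒮 γ H (d + 1))
    (T : ℕ) : ∃ A : Learner X 𝒮, A.regret H T ≤
      ((d + γ * T + √(2 * d * T * Real.log T) : ℝ) : EReal) := by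
  have : Nonempty Y := ⟨hH.some (Classical.arbitrary X)⟩
  obtain ⟨A, hA⟩ := exists_agnostic_learner hγ hd T
  refine ⟨A, ?_⟩
  -- For `T ≤ 1` the root in the target vanishes, so `T ≤ d` is used when `d > 0`. For `T ≥ 2`, `T +
  -- 1 ≤ T²` absorbs the shift inside the logarithm.
  rcases lt_or_ge T 2 with hT | hT
  · rcases Nat.eq_zero_or_pos d with rfl | hd0
    · refine A.regret_le_of_forall h𝒮 hH fun l hl g hg => ?_
      simpa using hA l hl g hg
    · refine (A.regret_le_horizon h𝒮 hH T).trans ?_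
      rw [← EReal.coe_natCast, EReal.coe_le_coe_iff]
      have h1 : (T : ℝ) ≤ d := by exact_mod_cast (by omega : T ≤ d)
      have h2 : 0 ≤ γ * T := by positivity
      have h3 := Real.sqrt_nonneg (2 * d * T * Real.log T)
      linarith
  · refine A.regret_le_of_forall h𝒮 hH fun l hl g hg => (hA l hl g hg).trans ?_
    have hT' : (2 : ℝ) ≤ T := by exact_mod_cast hT
    have hlog : 0 ≤ Real.log T := Real.log_nonneg (by linarith)
    have h1 : Real.log (T + 1) ≤ 2 * Real.log T := by
      rw [← Real.log_rpow (by linarith)]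
      refine Real.log_le_log (by linarith) ?_
      norm_num
      nlinarith
    have h2 : √(T * (d * Real.log (T + 1)) / 2) ≤ √(2 * d * T * Real.log T) := by
      refine Real.sqrt_le_sqrt ?_
      have h3 : (T : ℝ) * (d * Real.log (T + 1)) ≤ T * (d * (2 * Real.log T)) := by gcongr
      have h4 : 0 ≤ (d : ℝ) * T * Real.log T := by positivity
      linarith
    linarith

end MeasureSOA

theorem exists_natCast_eq_min (d : ℕ∞) (T : ℕ) :
    ∃ k : ℕ, min d T = k ∧ k ≤ T ∧ (k : ℕ∞) ≤ d := by
  have hne : min d (T : ℕ∞) ≠ ⊤ := ((min_le_right _ _).trans_lt (ENat.natCast_lt_top T)).ne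
  obtain ⟨k, hk⟩ := ENat.ne_top_iff_exists.1 hne
  refine ⟨k, hk.symm, ?_, hk ▸ min_le_left _ _⟩
  have : (k : ℕ∞) ≤ T := hk ▸ min_le_right _ _
  exact_mod_cast this

theorem rpow_half_natCast_mul_div_eight (k T : ℕ) :
    (((k : ℕ∞) : ℝ≥0∞) * T / 8) ^ (1 / 2 : ℝ) = ENNReal.ofReal √((k : ℝ) * T / 8) := by
  rw [Real.sqrt_eq_rpow, ← ENNReal.ofReal_rpow_of_nonneg (by positivity) (by norm_num),
    ENNReal.ofReal_div_of_pos (by norm_num), ENNReal.ofReal_mul (by positivity)]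
  simp

/-! ### Minimax bounds in terms of the dimensions -/

section Bounds

variable {X : Type u} {Y : Type v} [MeasurableSpace Y] {𝒮 : Set (Set Y)} {H : Set (X → Y)}

theorem ofReal_le_toENNReal_of_le {r : ℝ} {R : EReal} (h : (r : EReal) ≤ R) :
    ENNReal.ofReal r ≤ R.toENNReal := by
  simpa using EReal.toENNReal_le_toENNReal h

/-- A positive dimension at one scale yields a realizable example, hence a monotone regret; this
extends the bound at depth `min(MS_γ, T)` to horizon `T`. -/
theorem lowerBound_le_regret [Nonempty Y] (h𝒮 : ∀ S ∈ 𝒮, MeasurableSet S)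
    (hpos : ∃ γ ∈ Ioc (0 : ℝ) 1, msDim 𝒮 γ H ≠ 0) (A : Learner X 𝒮) (T : ℕ) :
    (lowerBound 𝒮 H T : EReal) ≤ A.regret H T := by
  obtain ⟨γ₀, -, hγ₀⟩ := hpos
  have hS₀ : MSShatters 𝒮 γ₀ H 1 := MSShatters.of_le_msDim one_ne_zero
    (by simpa using Order.one_le_iff_pos.2 (pos_iff_ne_zero.2 hγ₀))
  obtain ⟨h, hh, p, hp⟩ := hS₀.exists_realizable one_ne_zero
  have hmono := A.regret_monotone h𝒮 hh hp
  rw [← EReal.coe_toENNReal (A.regret_nonneg h𝒮 hh hp T), EReal.coe_ennreal_le_coe_ennreal_iff]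
  refine max_le ?_ (iSup₂_le fun γ hγ => ?_)
  · obtain ⟨k, hk, hkT, hkd⟩ := exists_natCast_eq_min (slDim 𝒮 2 H) T
    rw [hk, rpow_half_natCast_mul_div_eight]
    rcases eq_or_ne k 0 with rfl | hk0
    · simp
    · exact ofReal_le_toENNReal_of_le
        ((SLShatters.of_le_slDim hk0 hkd).sqrt_le_regret h𝒮 A hk0 hkT)
  · obtain ⟨k, hk, hkT, hkd⟩ := exists_natCast_eq_min (msDim 𝒮 γ H) T
    rw [hk]
    rcases eq_or_ne k 0 with rfl | hk0
    · simp
    · have h1 := ((MSShatters.of_le_msDim hk0 hkd).mul_le_regret h𝒮 A).trans (hmono hkT)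
      have h2 := ofReal_le_toENNReal_of_le h1
      rw [ENNReal.ofReal_mul hγ.1.le, ENNReal.ofReal_natCast] at h2
      simpa using h2

theorem lowerBound_le_minimaxRegret [Nonempty Y] (h𝒮 : ∀ S ∈ 𝒮, MeasurableSet S)
    (hpos : ∃ γ ∈ Ioc (0 : ℝ) 1, msDim 𝒮 γ H ≠ 0) (T : ℕ) :
    (lowerBound 𝒮 H T : EReal) ≤ minimaxRegret 𝒮 H T :=
  le_iInf fun A => lowerBound_le_regret h𝒮 hpos A T

theorem not_msShatters_of_msDim_eq {γ : ℝ} {d : ℕ} (hd : msDim 𝒮 γ H = d) :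
    ¬ MSShatters 𝒮 γ H (d + 1) := fun h => by
  have := h.le_msDim
  rw [hd] at this
  have h2 : d + 1 ≤ d := by exact_mod_cast this
  omega

theorem upperBound_term_eq {γ : ℝ} (hγ : 0 ≤ γ) (d T : ℕ) :
    (((d : ℕ∞) : ℝ≥0∞) + ENNReal.ofReal (γ * T) +
      (2 * ((d : ℕ∞) : ℝ≥0∞) * T * ENNReal.ofReal (Real.log T)) ^ (1 / 2 : ℝ)) =
      ENNReal.ofReal (d + γ * T + √(2 * d * T * Real.log T)) := by
  have hlog : 0 ≤ Real.log T := Real.log_natCast_nonneg T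
  rw [ENNReal.ofReal_add (by positivity) (Real.sqrt_nonneg _),
    ENNReal.ofReal_add (by positivity) (by positivity), Real.sqrt_eq_rpow,
    ← ENNReal.ofReal_rpow_of_nonneg (by positivity) (by norm_num),
    ENNReal.ofReal_mul (by positivity), ENNReal.ofReal_mul (by positivity),
    ENNReal.ofReal_mul (by positivity)]
  simp

theorem upperBound_le {γ : ℝ} (hγ : γ ∈ Ioc (0 : ℝ) 1) {d : ℕ} (hd : msDim 𝒮 γ H = d) (T : ℕ) :
    upperBound 𝒮 H T ≤ ENNReal.ofReal (d + γ * T + √(2 * d * T * Real.log T)) := by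
  refine (iInf₂_le γ hγ).trans_eq ?_
  rw [hd, upperBound_term_eq hγ.1.le]

theorem minimaxRegret_le_of_msDim_eq [Nonempty X] [Nonempty 𝒮] (h𝒮 : ∀ S ∈ 𝒮, MeasurableSet S)
    (hH : H.Nonempty) {γ : ℝ} (hγ : 0 ≤ γ) {d : ℕ} (hd : msDim 𝒮 γ H = d) (T : ℕ) :
    minimaxRegret 𝒮 H T ≤ ((d + γ * T + √(2 * d * T * Real.log T) : ℝ) : EReal) := by
  obtain ⟨A, hA⟩ := exists_regret_le h𝒮 hγ hH (not_msShatters_of_msDim_eq hd) T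
  exact (iInf_le _ A).trans hA

theorem minimaxRegret_le_upperBound [Nonempty X] [Nonempty 𝒮] (h𝒮 : ∀ S ∈ 𝒮, MeasurableSet S)
    (hH : H.Nonempty) (T : ℕ) :
    minimaxRegret 𝒮 H T ≤ (upperBound 𝒮 H T : EReal) := by
  suffices h : (minimaxRegret 𝒮 H T).toENNReal ≤ upperBound 𝒮 H T by
    refine le_trans ?_ (EReal.coe_ennreal_le_coe_ennreal_iff.2 h)
    rw [EReal.coe_toENNReal_eq_max]
    exact le_max_right _ _
  refine le_iInf₂ fun γ hγ => ?_
  rcases eq_or_ne (msDim 𝒮 γ H) ⊤ with htop | htop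
  · rw [htop]
    simp
  · obtain ⟨d, hd⟩ := ENat.ne_top_iff_exists.1 htop
    rw [← hd, upperBound_term_eq hγ.1.le, ← EReal.real_coe_toENNReal]
    exact EReal.toENNReal_le_toENNReal (minimaxRegret_le_of_msDim_eq h𝒮 hH hγ.1.le hd.symm T)

end Bounds

/-! ### Characterization of agnostic learnability -/

section Learnability

/-- Tangent-line bound `log n ≤ δ n + |log δ|`, with `δ` so small that `2 d δ ≤ ε²`, followed by
completing the square. -/
theorem exists_sqrt_log_le {d : ℕ} {ε : ℝ} (hε : 0 < ε) :
    ∃ K : ℝ, 0 ≤ K ∧ ∀ n : ℕ, √(2 * d * n * Real.log n) ≤ ε * n + K := by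
  set δ : ℝ := ε ^ 2 / (2 * (d + 1)) with hδ
  have hδ0 : 0 < δ := by positivity
  refine ⟨d * |Real.log δ| / ε, by positivity, fun n => ?_⟩
  rcases Nat.eq_zero_or_pos n with rfl | hn
  · simp; positivity
  have hn' : (0 : ℝ) < n := by exact_mod_cast hn
  have hlog : Real.log n ≤ δ * n + |Real.log δ| := by
    have h1 := Real.log_le_sub_one_of_pos (mul_pos hδ0 hn')
    rw [Real.log_mul hδ0.ne' hn'.ne'] at h1
    have := neg_abs_le (Real.log δ)
    linarith
  refine Real.sqrt_le_iff.2 ⟨by positivity, ?_⟩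
  set c := |Real.log δ|
  have hc : 0 ≤ c := abs_nonneg _
  have h2 : 2 * d * n * Real.log n ≤ 2 * d * n * (δ * n + c) := by gcongr
  have h3 : 2 * (d : ℝ) * δ ≤ ε ^ 2 := by
    rw [hδ]
    field_simp
    linarith
  have h4 : (ε * n + d * c / ε) ^ 2 = ε ^ 2 * n ^ 2 + 2 * d * n * c + (d * c / ε) ^ 2 := by
    field_simp
    ring
  rw [h4]
  have h5 : 2 * (d : ℝ) * δ * n ^ 2 ≤ ε ^ 2 * n ^ 2 := by gcongr
  nlinarith [sq_nonneg (d * c / ε)]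

variable {X : Type u} {Y : Type v} [MeasurableSpace Y] {𝒮 : Set (Set Y)} {H : Set (X → Y)}

/-- Restart: during the rounds `j ^ 2, …, (j + 1) ^ 2 - 1` play the learner `B j`. -/
def blockLearner (B : ℕ → Learner X 𝒮) : Learner X 𝒮 :=
  fun l x => B (Nat.sqrt l.length) (l.drop (Nat.sqrt l.length * Nat.sqrt l.length)) x

theorem blockLearner_cumLoss (B : ℕ → Learner X 𝒮) {j : ℕ} {pre l : List (X × 𝒮)}
    (hpre : pre.length = j * j) (hl : l.length ≤ 2 * j + 1) :
    (blockLearner B).cumLoss pre l = (B j).cumLoss [] l := by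
  refine Learner.cumLoss_congr fun l₁ p l₂ h => ?_
  have hlen : l₁.length ≤ j + j := by
    rw [h] at hl
    simp at hl
    omega
  have hs : Nat.sqrt (pre ++ l₁).length = j := by
    rw [List.length_append, hpre, Nat.sqrt_add_eq _ hlen]
  rw [blockLearner, hs, ← hpre, List.drop_left, List.nil_append]

/-- The loss of a fixed comparator is additive over blocks, so the constant `C` is paid only `J`
times in `J²` rounds. -/
theorem blockLearner_le_of_square (B : ℕ → Learner X 𝒮) {ε C : ℝ}
    (hB : ∀ j, ∀ l : List (X × 𝒮), l.length = 2 * j + 1 → ∀ h ∈ H,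
      (B j).cumLoss [] l ≤ hypLoss h l + (ε * (2 * j + 1) + C)) (J : ℕ) (l : List (X × 𝒮))
    (hl : l.length = J * J) (h : X → Y) (hh : h ∈ H) :
    (blockLearner B).cumLoss [] l ≤ hypLoss h l + (ε * (J * J) + C * J) := by
  induction J generalizing l with
  | zero =>
    rw [List.eq_nil_of_length_eq_zero hl]
    simp [Learner.cumLoss, hypLoss]
  | succ J ih =>
    obtain ⟨l₁, l₂, rfl, hl₁⟩ : ∃ l₁ l₂ : List (X × 𝒮), l = l₁ ++ l₂ ∧ l₁.length = J * J :=
      ⟨l.take (J * J), l.drop (J * J), (List.take_append_drop _ _).symm, by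
        rw [List.length_take, hl, min_eq_left]; nlinarith⟩
    have hl₂ : l₂.length = 2 * J + 1 := by
      rw [List.length_append, hl₁] at hl
      nlinarith
    have h1 := ih l₁ hl₁
    have h2 := hB J l₂ hl₂ h hh
    rw [Learner.cumLoss_append, List.nil_append, blockLearner_cumLoss B hl₁ hl₂.le, hypLoss_append]
    push_cast
    linarith

theorem blockLearner_le (B : ℕ → Learner X 𝒮) {ε C : ℝ} (hε : 0 < ε)
    (hB : ∀ j, ∀ l : List (X × 𝒮), l.length = 2 * j + 1 → ∀ h ∈ H,
      (B j).cumLoss [] l ≤ hypLoss h l + (ε * (2 * j + 1) + C)) :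
    ∀ᶠ T : ℕ in atTop, ∀ l : List (X × 𝒮), l.length = T → ∀ h ∈ H,
      (blockLearner B).cumLoss [] l ≤ hypLoss h l + 2 * ε * T := by
  obtain ⟨N, hN⟩ := exists_nat_ge ((C + 2) / ε)
  filter_upwards [eventually_ge_atTop (N * N)] with T hT l hl h hh
  set J := Nat.sqrt T
  have hJT : J * J ≤ T := Nat.sqrt_le T
  have hTJ : T ≤ J * J + J + J := Nat.sqrt_le_add T
  have hNJ : N ≤ J := Nat.le_sqrt.2 hT
  obtain ⟨l₁, l₂, rfl, hl₁⟩ : ∃ l₁ l₂ : List (X × 𝒮), l = l₁ ++ l₂ ∧ l₁.length = J * J :=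
    ⟨l.take (J * J), l.drop (J * J), (List.take_append_drop _ _).symm, by
      rw [List.length_take, hl, min_eq_left hJT]⟩
  have h1 := blockLearner_le_of_square B hB J l₁ hl₁ h hh
  -- The unfinished last block has at most `2 J` rounds and is bounded trivially.
  have h2 := (blockLearner B).cumLoss_le_length l₁ l₂
  have h3 : (l₂.length : ℝ) ≤ 2 * J := by
    rw [List.length_append, hl₁] at hl
    exact_mod_cast (by omega : l₂.length ≤ 2 * J)
  have h4 := hypLoss_nonneg h l₂
  have h5 : C + 2 ≤ ε * J := by
    have : (C + 2) / ε ≤ J := hN.trans (by exact_mod_cast hNJ)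
    rwa [div_le_iff₀ hε, mul_comm] at this
  have h6 : (J : ℝ) * J ≤ T := by exact_mod_cast hJT
  have h7 : (C + 2) * J ≤ ε * J * J := by gcongr
  have h8 : ε * (J * J) ≤ ε * T := by gcongr
  rw [Learner.cumLoss_append, List.nil_append, hypLoss_append]
  linarith

/-- The infimum lies between `0` and `T`, so adding one makes it strictly larger and a learner falls
below. -/
theorem exists_near_minimax (h𝒮 : ∀ S ∈ 𝒮, MeasurableSet S) {h : X → Y} (hh : h ∈ H)
    {p : X × 𝒮} (hp : h p.1 ∈ p.2.1) (A₀ : Learner X 𝒮) (T : ℕ) :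
    ∃ A : Learner X 𝒮, A.regret H T ≤ minimaxRegret 𝒮 H T + 1 := by
  have h0 : 0 ≤ minimaxRegret 𝒮 H T := le_iInf fun A => A.regret_nonneg h𝒮 hh hp T
  have h1 : minimaxRegret 𝒮 H T ≤ (T : EReal) :=
    (iInf_le _ A₀).trans (A₀.regret_le_horizon h𝒮 ⟨h, hh⟩ T)
  have hlt : minimaxRegret 𝒮 H T < minimaxRegret 𝒮 H T + 1 := by
    have hbot : minimaxRegret 𝒮 H T ≠ ⊥ := (EReal.bot_lt_zero.trans_le h0).ne'
    have htop : minimaxRegret 𝒮 H T ≠ ⊤ := (h1.trans_lt (EReal.coe_lt_top (T : ℝ))).ne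
    rw [← EReal.coe_toReal htop hbot]
    exact_mod_cast lt_add_one _
  obtain ⟨A, hA⟩ := iInf_lt_iff.1 hlt
  exact ⟨A, hA.le⟩

theorem Learner.cumLoss_le_of_regret_le (A : Learner X 𝒮) (h𝒮 : ∀ S ∈ 𝒮, MeasurableSet S) {B : ℝ}
    {l : List (X × 𝒮)} (hA : A.regret H l.length ≤ (B : EReal)) {h : X → Y} (hh : h ∈ H) :
    A.cumLoss [] l ≤ hypLoss h l + B := by
  have h1 := EReal.coe_le_coe_iff.1 ((A.le_regret h𝒮 H l).trans hA)
  have h2 := bestListLoss_le hh l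
  linarith

theorem agnosticLearnable_of_msDim_ne_top [Nonempty X] [Nonempty 𝒮]
    (h𝒮 : ∀ S ∈ 𝒮, MeasurableSet S) (hH : H.Nonempty)
    (hfin : ∀ γ ∈ Ioc (0 : ℝ) 1, msDim 𝒮 γ H ≠ ⊤) : AgnosticLearnable 𝒮 H := by
  have hY : Nonempty Y := ⟨hH.some (Classical.arbitrary X)⟩
  by_cases hreal : ∃ h ∈ H, ∃ p : X × 𝒮, h p.1 ∈ p.2.1
  · obtain ⟨h, hh, p, hp⟩ := hreal
    -- Near-minimax learners involve no scale `γ`, so a single restarted learner inherits the upper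
    -- bound at every scale.
    choose B hB using fun j : ℕ =>
      exists_near_minimax h𝒮 hh hp (fun _ _ => Classical.arbitrary _) (2 * j + 1)
    have key : ∀ ε : ℝ, 0 < ε → ∀ᶠ T : ℕ in atTop,
        (blockLearner B).regret H T ≤ ((2 * ε * T : ℝ) : EReal) := by
      intro ε hε
      set γ := min (ε / 2) 1
      have hγ : γ ∈ Ioc (0 : ℝ) 1 := ⟨lt_min (by positivity) one_pos, min_le_right _ _⟩
      obtain ⟨d, hd⟩ := ENat.ne_top_iff_exists.1 (hfin γ hγ)
      obtain ⟨K, hK0, hK⟩ := exists_sqrt_log_le (d := d) (half_pos hε)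
      have hbl := blockLearner_le (H := H) B (C := d + K + 1) hε
        fun j l hl g hg => (B j).cumLoss_le_of_regret_le h𝒮 (by
          rw [hl]
          refine (hB j).trans ((add_le_add_left
            (minimaxRegret_le_of_msDim_eq h𝒮 hH hγ.1.le hd.symm _) 1).trans ?_)
          have h1 := hK (2 * j + 1)
          have h2 : γ * (2 * j + 1 : ℕ) ≤ ε / 2 * (2 * j + 1 : ℕ) := by
            gcongr
            exact min_le_left _ _
          rw [← EReal.coe_one, ← EReal.coe_add, EReal.coe_le_coe_iff]
          push_cast at h1 h2 ⊢
          linarith) hg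
      filter_upwards [hbl] with T hT
      exact Learner.regret_le_of_forall _ h𝒮 hH hT
    refine ⟨blockLearner B, Learner.regret_monotone _ h𝒮 hh hp, tendsto_order.2 ⟨?_, ?_⟩⟩
    · intro a ha
      refine Eventually.of_forall fun T => ha.trans_le ?_
      exact EReal.div_nonneg (Learner.regret_nonneg _ h𝒮 hh hp T) (by positivity)
    · intro a ha
      obtain ⟨r, hr0, hra⟩ := EReal.lt_iff_exists_real_btwn.1 ha
      have hr0' : (0 : ℝ) < r := by exact_mod_cast hr0
      filter_upwards [key (r / 2) (by positivity), eventually_gt_atTop 0] with T hT hT0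
      refine lt_of_le_of_lt ?_ hra
      rw [← EReal.coe_natCast, EReal.div_le_iff_le_mul (by exact_mod_cast hT0) (EReal.coe_ne_top _),
        ← EReal.coe_mul]
      refine hT.trans_eq ?_
      congr 1
      ring
  -- When nothing is realizable every hypothesis errs in every round, and playing one of them has
  -- regret exactly zero.
  · push Not at hreal
    obtain ⟨h₀, hh₀⟩ := hH
    set A := Learner.ofHyp 𝒮 h₀ with hA
    have hval : ∀ l : List (X × 𝒮), A.cumLoss [] l = bestListLoss H l := by
      intro l
      obtain ⟨g, hg, hgl⟩ := exists_hypLoss_eq_bestListLoss ⟨h₀, hh₀⟩ l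
      rw [← hgl, hypLoss_eq_length fun q _ => hreal g hg q, hA,
        Learner.cumLoss_ofHyp h𝒮, hypLoss_eq_length fun q _ => hreal h₀ hh₀ q]
    have hzero : ∀ T, A.regret H T = 0 := by
      intro T
      refine le_antisymm (A.regret_le h𝒮 H fun l _ => by simp [hval]) ?_
      have := A.le_regret h𝒮 H (List.replicate T (Classical.arbitrary (X × 𝒮)))
      simpa [hval] using this
    refine ⟨A, fun m n _ => by rw [hzero, hzero], ?_⟩
    simp only [hzero, EReal.zero_div]
    exact tendsto_const_nhds

theorem AgnosticLearnable.msDim_ne_top [Nonempty Y] (h𝒮 : ∀ S ∈ 𝒮, MeasurableSet S)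
    (hL : AgnosticLearnable 𝒮 H) {γ : ℝ} (hγ : γ ∈ Ioc (0 : ℝ) 1) : msDim 𝒮 γ H ≠ ⊤ := by
  intro htop
  obtain ⟨A, -, hA⟩ := hL
  have h1 : ∀ᶠ T : ℕ in atTop, A.regret H T / (T : EReal) < (γ : EReal) :=
    hA.eventually_lt_const (by exact_mod_cast hγ.1)
  obtain ⟨T, hT, hT0⟩ := (h1.and (eventually_gt_atTop 0)).exists
  refine hT.not_ge ?_
  have hS : MSShatters 𝒮 γ H T := MSShatters.of_le_msDim hT0.ne' (by rw [htop]; exact le_top)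
  rw [← EReal.coe_natCast, EReal.le_div_iff_mul_le (by exact_mod_cast hT0) (EReal.coe_ne_top _),
    ← EReal.coe_mul]
  exact hS.mul_le_regret h𝒮 A

end Learnability

theorem coe_ennreal_natCast (n : ℕ) : ((n : ℝ≥0∞) : EReal) = n := by
  rw [← ENNReal.ofReal_natCast, EReal.coe_ennreal_ofReal, max_eq_left n.cast_nonneg]
  rfl

/-! ### Bounds at extreme values of the dimensions -/

section VanishingDimension

variable {X : Type u} {Y : Type v} [MeasurableSpace Y] {𝒮 : Set (Set Y)} {H : Set (X → Y)}

theorem msDim_eq_zero_of_not_msShatters_one [Nonempty Y] {γ : ℝ} (h : ¬ MSShatters 𝒮 γ H 1) :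
    msDim 𝒮 γ H = 0 := by
  by_contra h0
  exact h (MSShatters.of_le_msDim one_ne_zero
    (by simpa using Order.one_le_iff_pos.2 (pos_iff_ne_zero.2 h0)))

theorem msDim_eq_zero_of_prediction [Nonempty Y] {γ : ℝ} (μ : ProbabilityMeasure Y)
    (hμ : ∀ S ∈ 𝒮, 1 - γ < (μ : Measure Y).real S) : msDim 𝒮 γ H = 0 := by
  refine msDim_eq_zero_of_not_msShatters_one fun hS => ?_
  obtain ⟨l, hl, -, hγ⟩ := hS.exists_stream fun _ _ => μ
  cases l with
  | nil => simp at hl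
  | cons p l =>
    have h1 := hγ [] p l rfl
    have h2 := hμ _ p.2.2
    change γ ≤ 1 - (μ : Measure Y).real p.2.1 at h1
    linarith

theorem msDim_eq_zero_of_not_realizable [Nonempty Y] {γ : ℝ}
    (h : ∀ h ∈ H, ∀ p : X × 𝒮, h p.1 ∉ p.2.1) : msDim 𝒮 γ H = 0 := by
  refine msDim_eq_zero_of_not_msShatters_one fun hS => ?_
  obtain ⟨g, hg, p, hp⟩ := hS.exists_realizable one_ne_zero
  exact h g hg p hp

/-- The lower bound contains `γ T` for every `γ < 1`; let `γ → 1`. -/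
theorem natCast_le_lowerBound_of_msDim_eq_top (h : ∀ γ ∈ Ioo (0 : ℝ) 1, msDim 𝒮 γ H = ⊤) (T : ℕ) :
    (T : ℝ≥0∞) ≤ lowerBound 𝒮 H T := by
  have hlim : Tendsto (fun n : ℕ => ENNReal.ofReal (1 - 1 / ((n : ℝ) + 2)) * (T : ℝ≥0∞)) atTop
      (𝓝 (ENNReal.ofReal (1 - 0) * (T : ℝ≥0∞))) := by
    refine ENNReal.Tendsto.mul_const (ENNReal.tendsto_ofReal (tendsto_const_nhds.sub ?_))
      (Or.inr (ENNReal.natCast_ne_top T))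
    exact tendsto_const_nhds.div_atTop
      (tendsto_atTop_add_const_right _ _ tendsto_natCast_atTop_atTop)
  rw [sub_zero, ENNReal.ofReal_one, one_mul] at hlim
  refine le_of_tendsto' hlim fun n => ?_
  have hγ : (1 - 1 / ((n : ℝ) + 2)) ∈ Ioo (0 : ℝ) 1 := by
    have h2 : (1 : ℝ) / (n + 2) ≤ 1 / 2 :=
      one_div_le_one_div_of_le (by norm_num) (by linarith [n.cast_nonneg (α := ℝ)])
    have h3 : (0 : ℝ) < 1 / (n + 2) := by positivity
    constructor <;> linarith
  refine le_trans ?_ (le_max_right _ _)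
  refine le_trans (le_of_eq ?_) (le_iSup₂ (f := fun (γ : ℝ) (_ : γ ∈ Ioc (0 : ℝ) 1) =>
    ENNReal.ofReal γ * ((min (msDim 𝒮 γ H) T : ℕ∞) : ℝ≥0∞)) _ ⟨hγ.1, hγ.2.le⟩)
  rw [h _ hγ]
  simp

theorem upperBound_le_of_msDim_one_eq_zero (h : msDim 𝒮 1 H = 0) (T : ℕ) :
    upperBound 𝒮 H T ≤ T := by
  refine (upperBound_le ⟨one_pos, le_rfl⟩ (d := 0) (by simpa using h) T).trans_eq ?_
  simp

end VanishingDimension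

/-! ### Tightness: cofinite feedback on the natural numbers -/

section Cofinite

/-- The cofinite sets of natural numbers. -/
def cofiniteSets : Set (Set ℕ) := {S | S ∈ (cofinite : Filter ℕ)}

theorem exists_cofinite_measureReal_le (μ : ProbabilityMeasure ℕ) {ε : ℝ} (hε : 0 < ε) :
    ∃ S : cofiniteSets, (μ : Measure ℕ).real S.1 ≤ ε := by
  have hlim : Tendsto ((μ : Measure ℕ) ∘ fun n : ℕ => Ici n) atTop
      (𝓝 ((μ : Measure ℕ) (⋂ n : ℕ, Ici n))) :=
    tendsto_measure_iInter_atTop (fun n => measurableSet_Ici.nullMeasurableSet)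
      (fun m n h => Ici_subset_Ici.2 h) ⟨0, measure_ne_top _ _⟩
  have hempty : (⋂ n : ℕ, Ici n) = (∅ : Set ℕ) := by
    ext m
    simp only [mem_iInter, mem_Ici, mem_empty_iff_false, iff_false, not_forall, not_le]
    exact ⟨m + 1, m.lt_succ_self⟩
  rw [hempty, measure_empty] at hlim
  obtain ⟨n, hn⟩ := (hlim.eventually_lt_const (ENNReal.ofReal_pos.2 hε)).exists
  refine ⟨⟨Ici n, ?_⟩, ENNReal.toReal_le_of_le_ofReal hε.le hn.le⟩
  rw [cofiniteSets, mem_ofPred_eq, Nat.cofinite_eq_atTop]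
  exact Ici_mem_atTop n

/-- Every measure has a cofinite set of small mass, and the finitely many such sets along a path
share a point, whose constant function realizes the path. -/
theorem cofinite_msDim {γ : ℝ} (hγ : γ ∈ Ioo (0 : ℝ) 1) :
    msDim cofiniteSets γ (univ : Set (Unit → ℕ)) = ⊤ := by
  choose S hS using fun μ : ProbabilityMeasure ℕ =>
    exists_cofinite_measureReal_le μ (sub_pos.2 hγ.2)
  have key : ∀ d, MSShatters cofiniteSets γ (univ : Set (Unit → ℕ)) d := by
    intro d
    refine ⟨⟨fun _ => (), fun q => S (q.getLastD (Classical.arbitrary _))⟩, fun q hq => ?_,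
      fun q hq t ht => ?_⟩
    · have : ∀ᶠ y in cofinite, ∀ t ∈ Finset.range d,
          y ∈ (S ((q.take (t + 1)).getLastD (Classical.arbitrary _))).1 :=
        (eventually_all_finset _).2 fun t _ => (S _).2
      obtain ⟨y, hy⟩ := this.exists
      exact ⟨fun _ => y, mem_univ _, fun t ht => hy t (Finset.mem_range.2 ht)⟩
    · have : (q.take (t + 1)).getLastD (Classical.arbitrary _) = q[t] := by
        rw [List.take_succ_eq_append_getElem ht, List.getLastD_concat]
      simp only [this]
      exact hS _
  refine ENat.eq_top_iff_forall_ge.2 fun n => (key n).le_msDim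

/-- A probability measure equivalent to counting measure charges every non-empty set, and at scale
one the edges must be null. -/
theorem cofinite_msDim_one : msDim cofiniteSets 1 (univ : Set (Unit → ℕ)) = 0 := by
  refine msDim_eq_zero_of_prediction
    (⟨(Measure.count : Measure ℕ).toFinite, inferInstance⟩ : ProbabilityMeasure ℕ) fun S hS => ?_
  rw [sub_self, measureReal_def, ENNReal.toReal_pos_iff]
  refine ⟨pos_iff_ne_zero.2 fun h => ?_, measure_lt_top (Measure.count : Measure ℕ).toFinite S⟩
  have h' : (Measure.count : Measure ℕ).toFinite S = 0 := h
  rw [toFinite_apply_eq_zero_iff, Measure.count_eq_zero_iff] at h'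
  rw [h'] at hS
  exact (cofinite : Filter ℕ).empty_notMem hS

theorem cofinite_slDim : slDim cofiniteSets 2 (univ : Set (Unit → ℕ)) = 0 := by
  by_contra h0
  obtain ⟨τ, -, hτ⟩ := SLShatters.of_le_slDim one_ne_zero
    (by simpa using Order.one_le_iff_pos.2 (pos_iff_ne_zero.2 h0))
  have h1 := hτ [0] rfl 0 one_pos
  have h2 : (⋂ i : Fin 2, (τ.edge ([0].take 0 ++ [i])).1) ∈ (cofinite : Filter ℕ) :=
    iInter_mem.2 fun i => (τ.edge _).2
  rw [h1] at h2
  exact (cofinite : Filter ℕ).empty_notMem h2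

theorem cofinite_bounds (T : ℕ) :
    (lowerBound cofiniteSets (univ : Set (Unit → ℕ)) T : EReal) = T ∧
    minimaxRegret cofiniteSets (univ : Set (Unit → ℕ)) T = T ∧
    (upperBound cofiniteSets (univ : Set (Unit → ℕ)) T : EReal) = T := by
  have hne : Nonempty cofiniteSets := ⟨⟨univ, (univ_mem : univ ∈ (cofinite : Filter ℕ))⟩⟩
  have h𝒮 : ∀ S ∈ cofiniteSets, MeasurableSet S := fun _ _ => .of_discrete
  have h1 : (T : EReal) ≤ (lowerBound cofiniteSets (univ : Set (Unit → ℕ)) T : EReal) := by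
    have := EReal.coe_ennreal_le_coe_ennreal_iff.2
      (natCast_le_lowerBound_of_msDim_eq_top (fun γ hγ => cofinite_msDim hγ) T)
    rwa [coe_ennreal_natCast] at this
  have h2 : (lowerBound cofiniteSets (univ : Set (Unit → ℕ)) T : EReal) ≤
      minimaxRegret cofiniteSets (univ : Set (Unit → ℕ)) T :=
    lowerBound_le_minimaxRegret h𝒮 ⟨1 / 2, by norm_num, by
      rw [cofinite_msDim (by norm_num)]; exact ENat.top_ne_zero⟩ T
  have h3 := minimaxRegret_le_upperBound h𝒮 (univ_nonempty : (univ : Set (Unit → ℕ)).Nonempty) T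
  have h4 : (upperBound cofiniteSets (univ : Set (Unit → ℕ)) T : EReal) ≤ T := by
    have := EReal.coe_ennreal_le_coe_ennreal_iff.2
      (upperBound_le_of_msDim_one_eq_zero cofinite_msDim_one T)
    rwa [coe_ennreal_natCast] at this
  exact ⟨le_antisymm (h2.trans (h3.trans h4)) h1, le_antisymm (h3.trans h4) (h1.trans h2),
    le_antisymm h4 (h1.trans (h2.trans h3))⟩

end Cofinite

/-! ### Negative minimax regret -/

section Unrealizable

variable {X : Type u} {Y : Type v} [MeasurableSpace Y] {𝒮 : Set (Set Y)} {H : Set (X → Y)}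

theorem minimaxRegret_eq_neg_of_not_realizable [Nonempty X] [Nonempty 𝒮]
    (h𝒮 : ∀ S ∈ 𝒮, MeasurableSet S) (hH : H.Nonempty)
    (hr : ∀ h ∈ H, ∀ p : X × 𝒮, h p.1 ∉ p.2.1) {y : Y} (hy : ∀ S ∈ 𝒮, y ∈ S) (T : ℕ) :
    minimaxRegret 𝒮 H T = -(T : EReal) := by
  have hbest : ∀ l : List (X × 𝒮), bestListLoss H l = l.length := by
    intro l
    obtain ⟨g, hg, hgl⟩ := exists_hypLoss_eq_bestListLoss hH l
    rw [← hgl, hypLoss_eq_length fun p _ => hr g hg p]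
  have hcoe : -(T : EReal) = ((-(T : ℝ) : ℝ) : EReal) := by simp
  rw [hcoe]
  refine le_antisymm ((iInf_le _ (Learner.ofHyp 𝒮 fun _ => y)).trans ?_) (le_iInf fun A => ?_)
  · refine Learner.regret_le _ h𝒮 H fun l hl => ?_
    rw [Learner.cumLoss_ofHyp h𝒮, hypLoss_eq_zero fun p _ => hy _ p.2.2, hbest, hl, zero_sub]
  · have h1 := A.le_regret h𝒮 H (List.replicate T (Classical.arbitrary (X × 𝒮)))
    rw [hbest] at h1
    simp only [List.length_replicate] at h1
    refine le_trans (EReal.coe_le_coe_iff.2 ?_) h1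
    linarith [A.cumLoss_nonneg [] (List.replicate T (Classical.arbitrary (X × 𝒮)))]

end Unrealizable

/-! ### Comparison of the two dimensions -/

section BinaryToMeasure

variable {X : Type u} {Y : Type v} {𝒮 : Set (Set Y)}

theorem SLShatters.restrict_root {H : Set (X → Y)} {k : ℕ} (h : SLShatters 𝒮 2 H (k + 1)) :
    ∃ (x : X) (S : Fin 2 → 𝒮), Disjoint (S 0).1 (S 1).1 ∧
      ∀ b, SLShatters 𝒮 2 (restrict H (x, S b)) k := by
  obtain ⟨τ, hτ, hd⟩ := h
  refine ⟨τ.node [], fun b => τ.edge [b], ?_, fun b =>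
    ⟨⟨fun q => τ.node (b :: q), fun q => τ.edge (b :: q)⟩, fun q hq => ?_, fun q hq t ht => ?_⟩⟩
  · have := hd (List.replicate (k + 1) 0) (by simp) 0 k.succ_pos
    rw [Set.disjoint_iff_inter_eq_empty, ← this]
    ext y
    simp [Fin.forall_fin_two]
  · obtain ⟨g, hg, hgq⟩ := hτ (b :: q) (by simp [hq])
    refine ⟨g, ⟨hg, by simpa using hgq 0 k.succ_pos⟩, fun t ht => ?_⟩
    simpa using hgq (t + 1) (by omega)
  · simpa using hd (b :: q) (by simp [hq]) (t + 1) (by omega)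

variable [MeasurableSpace Y]

/-- One of two disjoint sets has measure at most one half. -/
theorem SLShatters.msShatters [Nonempty X] [Nonempty 𝒮] [Nonempty Y]
    (h𝒮 : ∀ S ∈ 𝒮, MeasurableSet S) {γ : ℝ} (hγ : γ ≤ 1 / 2) {H : Set (X → Y)} {k : ℕ}
    (h : SLShatters 𝒮 2 H k) : MSShatters 𝒮 γ H k := by
  induction k generalizing H with
  | zero =>
    obtain ⟨τ, hτ, -⟩ := h
    obtain ⟨g, hg, -⟩ := hτ [] rfl
    exact msShatters_zero_iff.2 ⟨g, hg⟩
  | succ k ih =>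
    obtain ⟨x, S, hS, hk⟩ := h.restrict_root
    refine MSShatters.succ x fun μ => ?_
    have h1 : (μ : Measure Y).real ((S 0).1 ∪ (S 1).1) ≤ 1 := measureReal_le_one
    rw [measureReal_union hS (h𝒮 _ (S 1).2)] at h1
    rcases le_total ((μ : Measure Y).real (S 0).1) ((μ : Measure Y).real (S 1).1) with hc | hc
    · exact ⟨S 0, by linarith, ih (hk 0)⟩
    · exact ⟨S 1, by linarith, ih (hk 1)⟩

theorem slDim_le_msDim [Nonempty X] [Nonempty 𝒮] [Nonempty Y]
    (h𝒮 : ∀ S ∈ 𝒮, MeasurableSet S) {γ : ℝ} (hγ : γ ≤ 1 / 2) (H : Set (X → Y)) :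
    slDim 𝒮 2 H ≤ msDim 𝒮 γ H :=
  iSup₂_le fun _ hd => (hd.msShatters h𝒮 hγ).le_msDim

end BinaryToMeasure

/-! ### Single-label feedback: the Boolean cube -/

section Cube

/-- The singletons of `Bool`. -/
abbrev boolSingletons : Set (Set Bool) := range fun y : Bool => ({y} : Set Bool)

theorem measurableSet_of_mem_boolSingletons : ∀ S ∈ boolSingletons, MeasurableSet S :=
  fun _ _ => .of_discrete

instance nonempty_boolSingletons : Nonempty boolSingletons := ⟨⟨{true}, true, rfl⟩⟩

theorem cube_slShatters (d : ℕ) [NeZero d] :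
    SLShatters boolSingletons 2 (univ : Set (Fin d → Bool)) d := by
  -- The node at depth `t` queries coordinate `t`; reduction modulo `d` has no effect at depths
  -- below `d`.
  refine ⟨⟨fun q => Fin.ofNat d q.length,
    fun q => ⟨{decide (q.getLastD 0 = 1)}, _, rfl⟩⟩, fun q hq => ?_, fun q hq t ht => ?_⟩
  · refine ⟨fun i => decide (q[i.1]'(hq ▸ i.2) = 1), mem_univ _, fun t ht => ?_⟩
    have htq : t < q.length := hq ▸ ht
    have h1 : ((Fin.ofNat d (q.take t).length : Fin d) : ℕ) = t := by
      simp [Nat.min_eq_left htq.le, Nat.mod_eq_of_lt ht]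
    have h2 : (q.take (t + 1)).getLastD 0 = q[t] := by
      rw [List.take_succ_eq_append_getElem htq, List.getLastD_concat]
    simp only [h1, h2, mem_singleton_iff]
  · ext y
    simp only [mem_iInter, List.getLastD_concat, mem_singleton_iff, mem_empty_iff_false, iff_false]
    intro h
    have h0 := h 0
    have h1 := h 1
    simp [h0] at h1

/-- The label `true` if it has been revealed for the instance, and `false` otherwise. -/
def recallLearner (d : ℕ) : Learner (Fin d) boolSingletons :=
  fun l x => open Classical in diracProba (decide (∃ p ∈ l, p.1 = x ∧ true ∈ p.2.1))

theorem recallLearner_eq {d : ℕ} {h : Fin d → Bool} {l : List (Fin d × boolSingletons)}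
    (hr : ∀ p ∈ l, h p.1 ∈ p.2.1) {x : Fin d} (hx : x ∈ l.map Prod.fst) :
    recallLearner d l x = diracProba (h x) := by
  classical
  have hsing : ∀ p ∈ l, p.2.1 = {h p.1} := by
    intro p hp
    obtain ⟨y, hy⟩ := p.2.2
    have := hr p hp
    rw [← hy] at this ⊢
    rw [mem_singleton_iff.1 this]
  obtain ⟨p, hp, rfl⟩ := List.mem_map.1 hx
  rw [recallLearner]
  congr 1
  by_cases ht : h p.1 = true
  · rw [ht, decide_eq_true_iff]
    exact ⟨p, hp, rfl, by rw [hsing p hp, ht]; rfl⟩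
  · rw [Bool.not_eq_true] at ht
    rw [ht, decide_eq_false_iff_not]
    rintro ⟨q, hq, hqp, htq⟩
    rw [hsing q hq, hqp, ht] at htq
    simp at htq

/-- On a realizable stream `recallLearner` loses nothing on a repeated instance, so a stream costing
`γ > 0` in every round has distinct instances. -/
theorem cube_msShatters_le {d k : ℕ} {γ : ℝ} (hγ : 0 < γ)
    (hS : MSShatters boolSingletons γ (univ : Set (Fin d → Bool)) k) : k ≤ d := by
  obtain ⟨l, rfl, ⟨h, -, hr⟩, hl⟩ := hS.exists_stream (recallLearner d)
  have key : (l.map Prod.fst).Nodup := by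
    clear hS
    induction l using List.reverseRecOn with
    | nil => simp
    | append_singleton l p ih =>
      have hrl : ∀ q ∈ l, h q.1 ∈ q.2.1 := fun q hq => hr q (by simp [hq])
      have h1 := ih (fun l₁ q l₂ hlq => hl l₁ q (l₂ ++ [p]) (by simp [hlq])) hrl
      have h2 : p.1 ∉ l.map Prod.fst := by
        intro hmem
        have h3 := hl l p [] rfl
        rw [Learner.roundLoss_eq_setLoss measurableSet_of_mem_boolSingletons
          (recallLearner_eq hrl hmem), setLoss_of_mem (hr p (by simp))] at h3
        linarith
      rw [List.map_append, List.map_singleton]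
      exact List.nodup_append_comm.1 (List.nodup_cons.2 ⟨h2, h1⟩)
  simpa using key.length_le_card

theorem cube_dim {d : ℕ} (hd : d ≠ 0) :
    slDim boolSingletons 2 (univ : Set (Fin d → Bool)) = d ∧
    ∀ γ ∈ Ioc (0 : ℝ) (1 / 2), msDim boolSingletons γ (univ : Set (Fin d → Bool)) = d := by
  have : NeZero d := ⟨hd⟩
  have h1 := (cube_slShatters d).le_slDim
  have h2 : ∀ γ : ℝ, 0 < γ → msDim boolSingletons γ (univ : Set (Fin d → Bool)) ≤ d :=
    fun γ hγ => iSup₂_le fun k hk => by exact_mod_cast cube_msShatters_le hγ hk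
  have h3 : ∀ γ ≤ (1 / 2 : ℝ), slDim boolSingletons 2 (univ : Set (Fin d → Bool)) ≤
      msDim boolSingletons γ (univ : Set (Fin d → Bool)) :=
    fun γ hγ => slDim_le_msDim measurableSet_of_mem_boolSingletons hγ _
  exact ⟨le_antisymm ((h3 _ le_rfl).trans (h2 _ (by norm_num))) h1,
    fun γ hγ => le_antisymm (h2 γ hγ.1) (h1.trans (h3 γ hγ.2))⟩

theorem cube_msDim_one (d : ℕ) :
    msDim boolSingletons 1 (univ : Set (Fin d → Bool)) = 0 := by
  obtain ⟨μ, hμ⟩ := exists_mixture (ι := Bool) (w := fun _ => 1 / 2) (fun _ => by norm_num)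
    (by simp) diracProba
  refine msDim_eq_zero_of_prediction μ ?_
  rintro _ ⟨y, rfl⟩
  have hval : ∀ b, ((diracProba b : ProbabilityMeasure Bool) : Measure Bool).real {y} =
      ({y} : Set Bool).indicator 1 b := by
    intro b
    rw [measureReal_def]
    change ((Measure.dirac b) {y}).toReal = _
    rw [Measure.dirac_apply' _ .of_discrete]
    by_cases hb : b = y <;> simp [hb]
  rw [hμ]
  simp only [hval]
  cases y <;> simp

theorem cube_minimaxRegret_le (d T : ℕ) :
    minimaxRegret boolSingletons (univ : Set (Fin d → Bool)) T ≤
      ((√((d : ℝ) * T / 2) : ℝ) : EReal) := by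
  obtain ⟨A, hA⟩ := exists_hedge (fun h : Fin d → Bool => Learner.ofHyp boolSingletons h) T
  refine (iInf_le _ A).trans (A.regret_le_of_forall measurableSet_of_mem_boolSingletons
    univ_nonempty fun l hl h _ => ?_)
  have h1 := hA l h hl
  rw [Learner.cumLoss_ofHyp measurableSet_of_mem_boolSingletons] at h1
  refine h1.trans (add_le_add_right (Real.sqrt_le_sqrt ?_) _)
  have h2 : Real.log (Fintype.card (Fin d → Bool)) = d * Real.log 2 := by
    simp [Real.log_pow]
  rw [h2]
  have h3 : Real.log 2 ≤ 1 := by linarith [Real.log_two_lt_d9]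
  have h4 : (T : ℝ) * (d * Real.log 2) ≤ T * (d * 1) := by gcongr
  linarith

theorem cube_sqrt_le_lowerBound {d T : ℕ} (hd : d ≠ 0) (hT : d ≤ T) :
    ENNReal.ofReal √((d : ℝ) * T / 8) ≤
      lowerBound boolSingletons (univ : Set (Fin d → Bool)) T := by
  refine le_trans (le_of_eq ?_) (le_max_left _ _)
  rw [(cube_dim hd).1, min_eq_left (by exact_mod_cast hT), rpow_half_natCast_mul_div_eight]

theorem cube_half_le_lowerBound {d T : ℕ} (hd : d ≠ 0) (hT : T ≤ d) :
    ENNReal.ofReal ((T : ℝ) / 2) ≤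
      lowerBound boolSingletons (univ : Set (Fin d → Bool)) T := by
  refine le_trans (le_trans (le_of_eq ?_) (le_iSup₂ (f := fun (γ : ℝ) (_ : γ ∈ Ioc (0 : ℝ) 1) =>
    ENNReal.ofReal γ * ((min (msDim boolSingletons γ (univ : Set (Fin d → Bool))) T : ℕ∞) : ℝ≥0∞))
    (1 / 2) (by norm_num))) (le_max_right _ _)
  rw [(cube_dim hd).2 _ (by norm_num), min_eq_right (by exact_mod_cast hT),
    show (T : ℝ) / 2 = 1 / 2 * T by ring, ENNReal.ofReal_mul (by norm_num)]
  simp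

/-- For `T ≥ d` Hedge gives `√(d T / 2) = 2 √(d T / 8)`; for `T ≤ d` the trivial regret `T` is twice
the bound at scale `1 / 2`. -/
theorem cube_minimaxRegret_le_two_mul {d : ℕ} (hd : d ≠ 0) (T : ℕ) :
    minimaxRegret boolSingletons (univ : Set (Fin d → Bool)) T ≤
      ((2 * lowerBound boolSingletons (univ : Set (Fin d → Bool)) T : ℝ≥0∞) : EReal) := by
  have key : ∀ r : ℝ, 0 ≤ r →
      ENNReal.ofReal r ≤ lowerBound boolSingletons (univ : Set (Fin d → Bool)) T →
      ((2 * r : ℝ) : EReal) ≤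
        ((2 * lowerBound boolSingletons (univ : Set (Fin d → Bool)) T : ℝ≥0∞) : EReal) := by
    intro r hr h
    have h1 : ENNReal.ofReal (2 * r) ≤
        2 * lowerBound boolSingletons (univ : Set (Fin d → Bool)) T := by
      rw [ENNReal.ofReal_mul (by norm_num), ENNReal.ofReal_ofNat]
      gcongr
    have h2 := EReal.coe_ennreal_le_coe_ennreal_iff.2 h1
    rwa [EReal.coe_ennreal_ofReal, max_eq_left (by positivity)] at h2
  rcases le_total d T with hT | hT
  · refine le_trans (cube_minimaxRegret_le d T) (le_trans (le_of_eq ?_)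
      (key _ (Real.sqrt_nonneg _) (cube_sqrt_le_lowerBound hd hT)))
    rw [show (d : ℝ) * T / 2 = 2 ^ 2 * (d * T / 8) by ring, Real.sqrt_mul (by norm_num),
      Real.sqrt_sq (by norm_num)]
  · have h1 := (iInf_le (fun A : Learner (Fin d) boolSingletons => A.regret univ T)
      (recallLearner d)).trans ((recallLearner d).regret_le_horizon
      measurableSet_of_mem_boolSingletons (univ_nonempty (α := Fin d → Bool)) T)
    refine h1.trans (le_trans (le_of_eq ?_)
      (key _ (by positivity) (cube_half_le_lowerBound hd hT)))
    rw [mul_div_cancel₀ _ (two_ne_zero' ℝ)]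
    simp

theorem cube_upperBound_le {d : ℕ} (hd : d ≠ 0) {T : ℕ} (hT : 2 ≤ T) :
    (upperBound boolSingletons (univ : Set (Fin d → Bool)) T : EReal) ≤
      ((8 * √(Real.log T) : ℝ) : EReal) *
        minimaxRegret boolSingletons (univ : Set (Fin d → Bool)) T := by
  have : NeZero d := ⟨hd⟩
  have hL := lowerBound_le_minimaxRegret measurableSet_of_mem_boolSingletons
    (H := (univ : Set (Fin d → Bool))) ⟨1 / 2, by norm_num, by
      rw [(cube_dim hd).2 _ (by norm_num)]; exact_mod_cast hd⟩ T
  have key : ∀ u r : ℝ, 0 ≤ u → 0 ≤ r →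
      upperBound boolSingletons (univ : Set (Fin d → Bool)) T ≤ ENNReal.ofReal u →
      ENNReal.ofReal r ≤ lowerBound boolSingletons (univ : Set (Fin d → Bool)) T →
      u ≤ 8 * √(Real.log T) * r →
      (upperBound boolSingletons (univ : Set (Fin d → Bool)) T : EReal) ≤
      ((8 * √(Real.log T) : ℝ) : EReal) *
        minimaxRegret boolSingletons (univ : Set (Fin d → Bool)) T := by
    intro u r hu hr h1 h2 h3
    have h4 := EReal.coe_ennreal_le_coe_ennreal_iff.2 h1
    have h5 := (EReal.coe_ennreal_le_coe_ennreal_iff.2 h2).trans hL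
    rw [EReal.coe_ennreal_ofReal, max_eq_left hu] at h4
    rw [EReal.coe_ennreal_ofReal, max_eq_left hr] at h5
    refine h4.trans ((EReal.coe_le_coe_iff.2 h3).trans ?_)
    rw [EReal.coe_mul]
    exact mul_le_mul_of_nonneg_left h5 (EReal.coe_nonneg.2 (by positivity))
  have hT' : (2 : ℝ) ≤ T := by exact_mod_cast hT
  have hlog : 0.69 ≤ Real.log T :=
    (by linarith [Real.log_two_gt_d9] : (0.69 : ℝ) ≤ Real.log 2).trans
      (Real.log_le_log (by norm_num) hT')
  have hd0 : (0 : ℝ) < d := by exact_mod_cast Nat.pos_of_ne_zero hd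
  rcases le_total d T with hdT | hdT
  · have hdT' : (d : ℝ) ≤ T := by exact_mod_cast hdT
    -- With this scale the first two terms of the upper bound sum to `1.1 d`, which the root absorbs
    -- because `1.21 ≤ 2 · 0.69`.
    have hγ : (d : ℝ) / (10 * T) ∈ Ioc (0 : ℝ) (1 / 2) := by
      refine ⟨by positivity, ?_⟩
      rw [div_le_iff₀ (by positivity)]
      linarith
    refine key _ _ (by positivity) (Real.sqrt_nonneg _)
      (upperBound_le ⟨hγ.1, hγ.2.trans (by norm_num)⟩ ((cube_dim hd).2 _ hγ) T)
      (cube_sqrt_le_lowerBound hd hdT) ?_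
    have e1 : 8 * √(Real.log T) * √(d * T / 8) = 2 * √(2 * d * T * Real.log T) := by
      rw [mul_assoc, ← Real.sqrt_mul (by linarith : 0 ≤ Real.log T),
        show 2 * (d : ℝ) * T * Real.log T = 4 ^ 2 * (Real.log T * (d * T / 8)) by ring,
        Real.sqrt_mul (by norm_num : (0 : ℝ) ≤ 4 ^ 2), Real.sqrt_sq (by norm_num)]
      ring
    have e2 : d + d / (10 * T) * T = 1.1 * (d : ℝ) := by
      field_simp
      norm_num
    have e3 : 1.1 * (d : ℝ) ≤ √(2 * d * T * Real.log T) := by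
      refine Real.le_sqrt_of_sq_le ?_
      have h1 : (d : ℝ) * d * 0.69 ≤ d * T * Real.log T := by gcongr
      nlinarith
    rw [e1, e2]
    linarith
  -- Scale one bounds the upper bound by `T`, and `√(log T) ≥ 1 / 2` suffices.
  · refine key T (T / 2) (by positivity) (by positivity) ?_ (cube_half_le_lowerBound hd hdT) ?_
    · simpa using upperBound_le_of_msDim_one_eq_zero (cube_msDim_one d) T
    · have h1 : (1 / 2 : ℝ) ≤ √(Real.log T) := Real.le_sqrt_of_sq_le (by norm_num; linarith)
      nlinarith

end Cube

end SetFeedback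

end

theorem mainTheorem1 :
    (∀ {X : Type*} {Y : Type*} [Nonempty X] [MeasurableSpace Y] (𝒮 : Set (Set Y))
      (H : Set (X → Y)), (∀ S ∈ 𝒮, MeasurableSet S) → 𝒮.Nonempty → H.Nonempty →
        ((∃ γ ∈ Ioc (0 : ℝ) 1, SetFeedback.msDim 𝒮 γ H ≠ 0) → ∀ T : ℕ,
          (SetFeedback.lowerBound 𝒮 H T : EReal) ≤ SetFeedback.minimaxRegret 𝒮 H T) ∧
        (∀ T : ℕ,
          SetFeedback.minimaxRegret 𝒮 H T ≤ (SetFeedback.upperBound 𝒮 H T : EReal)) ∧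
        (SetFeedback.AgnosticLearnable 𝒮 H ↔
          ∀ γ ∈ Ioc (0 : ℝ) 1, SetFeedback.msDim 𝒮 γ H ≠ ⊤)) ∧
    -- the lower bound can be attained, with vanishing `SL₂`
    (∃ (X Y : Type) (_ : Nonempty X) (_ : MeasurableSpace Y) (𝒮 : Set (Set Y))
      (H : Set (X → Y)), (∀ S ∈ 𝒮, MeasurableSet S) ∧ 𝒮.Nonempty ∧ H.Nonempty ∧
        SetFeedback.slDim 𝒮 2 H = 0 ∧
        ∀ T : ℕ, 1 ≤ T → 0 < SetFeedback.lowerBound 𝒮 H T ∧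
          SetFeedback.minimaxRegret 𝒮 H T = (SetFeedback.lowerBound 𝒮 H T : EReal)) ∧
    -- the upper bound can be attained
    (∃ (X Y : Type) (_ : Nonempty X) (_ : MeasurableSpace Y) (𝒮 : Set (Set Y))
      (H : Set (X → Y)), (∀ S ∈ 𝒮, MeasurableSet S) ∧ 𝒮.Nonempty ∧ H.Nonempty ∧
        ∀ T : ℕ, 1 ≤ T → 0 < SetFeedback.upperBound 𝒮 H T ∧
          SetFeedback.minimaxRegret 𝒮 H T = (SetFeedback.upperBound 𝒮 H T : EReal)) ∧
    -- single-label feedback, every finite dimension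
    (∀ d : ℕ, 1 ≤ d →
      ∃ (X Y : Type) (_ : Nonempty X) (_ : MeasurableSpace Y) (𝒮 : Set (Set Y))
        (H : Set (X → Y)), (∀ S ∈ 𝒮, MeasurableSet S) ∧ 𝒮.Nonempty ∧ H.Nonempty ∧
          𝒮 = Set.range (fun y : Y => ({y} : Set Y)) ∧
          SetFeedback.slDim 𝒮 2 H = d ∧
          (∀ γ ∈ Ioc (0 : ℝ) (1 / 2), SetFeedback.msDim 𝒮 γ H = d) ∧
          (∀ T : ℕ, SetFeedback.minimaxRegret 𝒮 H T ≤
            ((2 * SetFeedback.lowerBound 𝒮 H T : ENNReal) : EReal)) ∧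
          (∀ T : ℕ, 2 ≤ T → (SetFeedback.upperBound 𝒮 H T : EReal) ≤
            ((8 * Real.sqrt (Real.log T) : ℝ) : EReal) * SetFeedback.minimaxRegret 𝒮 H T)) ∧
    -- no non-negative lower bound when `MS` vanishes at every scale
    (∃ (X Y : Type) (_ : Nonempty X) (_ : MeasurableSpace Y) (𝒮 : Set (Set Y))
      (H : Set (X → Y)), (∀ S ∈ 𝒮, MeasurableSet S) ∧ 𝒮.Nonempty ∧ H.Nonempty ∧
        (∀ γ ∈ Ioc (0 : ℝ) 1, SetFeedback.msDim 𝒮 γ H = 0) ∧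
        ∀ T : ℕ, SetFeedback.minimaxRegret 𝒮 H T = -(T : EReal)) := by
  refine ⟨fun {X Y} _ _ 𝒮 H h𝒮 hne hH => ?_, ?_, ?_, fun d hd => ?_, ?_⟩
  · have hY : Nonempty Y := ⟨hH.some (Classical.arbitrary X)⟩
    have hS : Nonempty 𝒮 := hne.to_subtype
    exact ⟨SetFeedback.lowerBound_le_minimaxRegret h𝒮,
      SetFeedback.minimaxRegret_le_upperBound h𝒮 hH,
      fun hL γ hγ => hL.msDim_ne_top h𝒮 hγ,
      SetFeedback.agnosticLearnable_of_msDim_ne_top h𝒮 hH⟩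
  · refine ⟨Unit, ℕ, inferInstance, inferInstance, SetFeedback.cofiniteSets, univ,
      fun _ _ => .of_discrete, ⟨univ, (univ_mem : univ ∈ (cofinite : Filter ℕ))⟩, univ_nonempty,
      SetFeedback.cofinite_slDim, fun T hT => ?_⟩
    obtain ⟨hL, hR, -⟩ := SetFeedback.cofinite_bounds T
    refine ⟨?_, hR.trans hL.symm⟩
    rw [← EReal.coe_ennreal_pos, hL]
    exact_mod_cast hT
  · refine ⟨Unit, ℕ, inferInstance, inferInstance, SetFeedback.cofiniteSets, univ,
      fun _ _ => .of_discrete, ⟨univ, (univ_mem : univ ∈ (cofinite : Filter ℕ))⟩, univ_nonempty,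
      fun T hT => ?_⟩
    obtain ⟨-, hR, hU⟩ := SetFeedback.cofinite_bounds T
    refine ⟨?_, hR.trans hU.symm⟩
    rw [← EReal.coe_ennreal_pos, hU]
    exact_mod_cast hT
  · have hd0 : d ≠ 0 := Nat.one_le_iff_ne_zero.1 hd
    exact ⟨Fin d, Bool, ⟨⟨0, hd⟩⟩, inferInstance, SetFeedback.boolSingletons, univ,
      SetFeedback.measurableSet_of_mem_boolSingletons, range_nonempty _, univ_nonempty, rfl,
      (SetFeedback.cube_dim hd0).1, (SetFeedback.cube_dim hd0).2,
      SetFeedback.cube_minimaxRegret_le_two_mul hd0,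
      fun T hT => SetFeedback.cube_upperBound_le hd0 hT⟩
  -- The only feedback is `{false}` and the only hypothesis is constantly `true`, so the learner can
  -- always be right while the class is always wrong.
  · have hr : ∀ h ∈ ({fun _ => true} : Set (Unit → Bool)),
        ∀ p : Unit × ({{false}} : Set (Set Bool)), h p.1 ∉ p.2.1 := by
      rintro _ rfl ⟨-, _, rfl⟩
      simp
    exact ⟨Unit, Bool, inferInstance, inferInstance, {{false}}, {fun _ => true},
      fun _ _ => .of_discrete, singleton_nonempty _, singleton_nonempty _,
      fun γ _ => SetFeedback.msDim_eq_zero_of_not_realizable hr,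
      SetFeedback.minimaxRegret_eq_neg_of_not_realizable (fun _ _ => .of_discrete)
        (singleton_nonempty _) hr (y := false) (by rintro _ rfl; rfl)⟩
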